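/- Let $\gamma\in\mathbb R$, $N\in\mathbb Z_{\ge 0}$ and $J=[x^+,x^-]\subset\mathbb R$ with $x^+<x^-$. *Wavefunctions.* Let $S_N$ act on $\mathbb R^N$ by permuting coordinates, $(w\bm x)_{w(j)}=x_j$, and on functions by $(wf)(\bm x)=f(w^{-1}\bm x)$; let $\mathbb R^N_+=\{\bm x: x_1>\dots>x_N\}$. For continuous $f:\mathbb R^N\to\mathbb C$ put $(I_{jk}f)(\bm x)=\int_0^{x_j-x_k}f(\bm x-y(\bm e_j-\bm e_k))\,dy$. With $s_j$ the transposition of $j$ and $j+1$, put $s_j^\gamma=s_j+\gamma I_{j,j+1}$, and for $w=s_{i_1}\cdots s_{i_l}\in S_N$ put $w^\gamma=s_{i_1}^\gamma\cdots s_{i_l}^\gamma$ (this does not depend on the decomposition). The propagation operator $P^\gamma$ is given by $P^\gamma f=w^{-1}w^\gamma f$ on $w^{-1}\mathbb R^N_+$ for $w\in S_N$, extended continuously to $\mathbb R^N$. For $\bm\lambda\in\mathbb C^N$ the non-symmetric wavefunction is $\psi_{\bm\lambda}=P^\gamma e^{i\bm\lambda}$, where $e^{i\bm\lambda}(\bm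 x)=e^{i\sum_j\lambda_jx_j}$. *Operators.* For $\mu\in\mathbb C$, the operators $a^\pm_\mu$ act on continuous functions $f$ on $J^N$ by $a^\pm_\mu=\sum_{n=0}^N\gamma^n\sum_{\bm i}\bar e^\pm_{\mu;\bm i}$, where $\bm i=(i_1,\dots,i_n)$ runs over the $n$-tuples of distinct elements of $\{1,\dots,N\}$ and $$(\bar e^+_{\mu;\bm i}f)(\bm x)=e^{i\mu x^+}\,\theta_{\bm i}^+(\bm x)\Big(\prod_{m=1}^n\int_{x_{i_{m+1}}}^{x_{i_m}}dy_m\,e^{i\mu(x_{i_m}-y_m)}\Big)f(\bm x_{\bm i\to\bm y}),\qquad x_{i_{n+1}}:=x^+,$$ $$(\bar e^-_{\mu;\bm i}f)(\bm x)=e^{i\mu x^-}\,\theta_{\bm i}^-(\bm x)\Big(\prod_{m=1}^n\int_{x_{i_m}}^{x_{i_{m-1}}}dy_m\,e^{i\mu(x_{i_m}-y_m)}\Big)f(\bm x_{\bm i\to\bm y}),\qquad x_{i_0}:=x^-.$$ Here $\bm x_{\bm i\to\bm y}$ is $\bm x$ with $x_{i_m}$ replaced by $y_m$ for every $m$. The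 factor $\theta^+_{\bm i}(\bm x)$ is $1$ if $x_{i_1}>\dots>x_{i_n}>x^+$ and $0$ otherwise; $\theta^-_{\bm i}(\bm x)$ is $1$ if $x^->x_{i_1}>\dots>x_{i_n}$ and $0$ otherwise; both are $1$ for $n=0$. (Equivalently, $a^\pm_\mu$ is the non-symmetric creation operator $b^\pm_\mu$ followed by evaluation of the new particle coordinate at $x^\pm$.) *Coefficients.* Let $\mathfrak I^n_{[1,N]}$ be the set of $n$-tuples $1\le i_1<\dots<i_n\le N$, and write $\bm i^+=(i_1+1,\dots,i_n+1)$. Define $a^\pm_{\bm i}(\bm\lambda;\mu)$ by $a^\pm_\emptyset(\emptyset;\mu)=e^{i\mu x^\pm}$ for $N=0$ and, for $N\ge 1$, by $$a^+_{\bm i^+}(\lambda_1,\dots,\lambda_N;\mu)=\tfrac{\lambda_1-\mu-i\gamma}{\lambda_1-\mu}\,a^+_{\bm i}(\lambda_2,\dots,\lambda_N;\mu),\qquad a^+_{(1,(\bm i')^+)}(\lambda_1,\dots,\lambda_N;\mu)=\tfrac{i\gamma}{\lambda_1-\mu}\,a^+_{\bm i'}(\lambda_2,\dots,\lambda_N;\lambda_1),$$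 $$a^-_{\bm i}(\lambda_1,\dots,\lambda_N;\mu)=\tfrac{\lambda_N-\mu+i\gamma}{\lambda_N-\mu}\,a^-_{\bm i}(\lambda_1,\dots,\lambda_{N-1};\mu),\qquad a^-_{(\bm i',N)}(\lambda_1,\dots,\lambda_N;\mu)=\tfrac{-i\gamma}{\lambda_N-\mu}\,a^-_{\bm i'}(\lambda_1,\dots,\lambda_{N-1};\lambda_N),$$ for $\bm i\in\mathfrak I^n_{[1,N-1]}$ and $\bm i'\in\mathfrak I^{n-1}_{[1,N-1]}$. **Theorem.** Let $\bm\lambda\in\mathbb C^N$ and $\lambda_0,\lambda_{N+1}\in\mathbb C$. For $\bm i\in\mathfrak I^n_{[1,N]}$ write $i_0=0$, $i_{n+1}=N+1$. Let $\bm\lambda^{+,\bm i}$ be $\bm\lambda$ with the entry at position $i_m$ replaced by $\lambda_{i_{m-1}}$, and $\bm\lambda^{-,\bm i}$ be $\bm\lambda$ with the entry at position $i_m$ replaced by $\lambda_{i_{m+1}}$, for all $m=1,\dots,n$. Then, pointwise on $J^N$, $$a^+_{\lambda_0}\psi_{\bm\lambda}=\sum_{n=0}^N\sum_{\bm i\in\mathfrak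 I^n_{[1,N]}}a^+_{\bm i}(\bm\lambda;\lambda_0)\,\psi_{\bm\lambda^{+,\bm i}}\quad\text{if }\lambda_0,\lambda_1,\dots,\lambda_N\text{ are pairwise distinct},$$ $$a^-_{\lambda_{N+1}}\psi_{\bm\lambda}=\sum_{n=0}^N\sum_{\bm i\in\mathfrak I^n_{[1,N]}}a^-_{\bm i}(\bm\lambda;\lambda_{N+1})\,\psi_{\bm\lambda^{-,\bm i}}\quad\text{if }\lambda_1,\dots,\lambda_{N+1}\text{ are pairwise distinct}.$$ For arbitrary $\bm\lambda,\lambda_0,\lambda_{N+1}$ the same holds with the right-hand side replaced by its pointwise limit on $J^N$ as the spectral parameters tend to the given ones through pairwise distinct values; in particular, this limit exists. -/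

import Mathlib

namespace QNLS

open Finset

/-! Throughout, `γ : ℝ` is the coupling constant; functions of `N` particle coordinates are maps
`(Fin N → ℝ) → ℂ`. Particle labels `1, …, N` are represented by `0, …, N - 1 : Fin N`. -/

/-- A pair `(j, j + 1)` of neighbouring labels, indexing the simple transposition `s_j`. -/
abbrev Adj (N : ℕ) : Type := {p : Fin N × Fin N // (p.1 : ℕ) + 1 = (p.2 : ℕ)}

/-- The permutation `s_{i_1} ⋯ s_{i_l}` given by a word in the simple transpositions. -/
def wordPerm {N : ℕ} (l : List (Adj N)) : Equiv.Perm (Fin N) :=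
  (l.map fun p => Equiv.swap p.1.1 p.1.2).prod

/-- Every permutation is a product of simple transpositions. -/
theorem exists_word {N : ℕ} (w : Equiv.Perm (Fin N)) : ∃ l : List (Adj N), wordPerm l = w := by
  cases N with
  | zero => exact ⟨[], Subsingleton.elim _ _⟩
  | succ n =>
    have h : w ∈ Submonoid.closure
        (Set.range fun i : Fin n => Equiv.swap i.castSucc i.succ) := by
      rw [Equiv.Perm.mclosure_swap_castSucc_succ]; trivial
    induction h using Submonoid.closure_induction with
    | mem x hx =>
      obtain ⟨i, rfl⟩ := hx
      exact ⟨[⟨(i.castSucc, i.succ), by simp⟩], by simp [wordPerm]⟩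
    | one => exact ⟨[], by simp [wordPerm]⟩
    | mul x y _ _ hx hy =>
      obtain ⟨l, rfl⟩ := hx
      obtain ⟨m, rfl⟩ := hy
      exact ⟨l ++ m, by simp [wordPerm]⟩

/-- The left action of permutations on `ℝ^N`: `(w x)_{w(j)} = x_j`. -/
def act {N : ℕ} (w : Equiv.Perm (Fin N)) (x : Fin N → ℝ) : Fin N → ℝ :=
  fun j => x (w⁻¹ j)

/-- The integral operator
`(I_{jk} f)(x) = ∫_0^{x_j - x_k} f (x - y (e_j - e_k)) dy`. -/
noncomputable def intOp {N : ℕ} (j k : Fin N) (f : (Fin N → ℝ) → ℂ) (x : Fin N → ℝ) : ℂ :=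
  ∫ y in (0 : ℝ)..(x j - x k),
    f (x - y • ((Pi.single j 1 : Fin N → ℝ) - (Pi.single k 1 : Fin N → ℝ)))

/-- The integral-reflection operator `s_j^γ = s_j + γ I_{j, j+1}`,
where `(w f)(x) = f (w⁻¹ x)`. -/
noncomputable def simpleRefl {N : ℕ} (γ : ℝ) (p : Adj N) (f : (Fin N → ℝ) → ℂ) :
    (Fin N → ℝ) → ℂ :=
  fun x => f (act (Equiv.swap p.1.1 p.1.2)⁻¹ x) + (γ : ℂ) * intOp p.1.1 p.1.2 f x

/-- The operator `s_{i_1}^γ ⋯ s_{i_l}^γ` given by a word in the simple transpositions. -/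
noncomputable def wordRefl {N : ℕ} (γ : ℝ) (l : List (Adj N)) (f : (Fin N → ℝ) → ℂ) :
    (Fin N → ℝ) → ℂ :=
  l.foldr (simpleRefl γ) f

/-- The operator `w^γ = s_{i_1}^γ ⋯ s_{i_l}^γ`, where `w = s_{i_1} ⋯ s_{i_l}`. On continuous
functions it does not depend on the decomposition of `w` that is used. -/
noncomputable def permRefl {N : ℕ} (γ : ℝ) (w : Equiv.Perm (Fin N)) (f : (Fin N → ℝ) → ℂ) :
    (Fin N → ℝ) → ℂ :=
  wordRefl γ (exists_word w).choose f

/-- A permutation `w` such that `w x` is weakly decreasing, i.e. such that `x` lies in the closure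
of the alcove `w⁻¹ ℝ^N_+`. It is unique if the coordinates of `x` are distinct. -/
noncomputable def sorter {N : ℕ} (x : Fin N → ℝ) : Equiv.Perm (Fin N) :=
  (Tuple.sort fun j => OrderDual.toDual (x j))⁻¹

theorem antitone_act_sorter {N : ℕ} (x : Fin N → ℝ) : Antitone (act (sorter x) x) := by
  intro j k hjk
  have h := Tuple.monotone_sort (fun j => OrderDual.toDual (x j)) hjk
  simpa [act, sorter] using h

/-- Gutkin's propagation operator: `P^γ f = w⁻¹ w^γ f` on the alcove `w⁻¹ ℝ^N_+`. For continuous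
`f` the expressions for adjacent alcoves agree on their common walls (since `I_{jk} f` vanishes where
`x_j = x_k`), so that on the walls this is the continuous extension. -/
noncomputable def propagation {N : ℕ} (γ : ℝ) (f : (Fin N → ℝ) → ℂ) (x : Fin N → ℝ) : ℂ :=
  permRefl γ (sorter x) f (act (sorter x) x)

/-- The plane wave `e^{iλ}(x) = exp (i ∑_j λ_j x_j)`. -/
noncomputable def planeWave {N : ℕ} (lam : Fin N → ℂ) (x : Fin N → ℝ) : ℂ :=
  Complex.exp (Complex.I * ∑ j, lam j * (x j : ℂ))

/-- The non-symmetric wavefunction `ψ_λ = P^γ e^{iλ}`. -/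
noncomputable def psi {N : ℕ} (γ : ℝ) (lam : Fin N → ℂ) : (Fin N → ℝ) → ℂ :=
  propagation γ (planeWave lam)

/-- Tuples of `n` distinct labels in `{1, …, N}`. -/
noncomputable def injTuples (n N : ℕ) : Finset (Fin n → Fin N) :=
  open Classical in univ.filter Function.Injective

/-- Strictly increasing tuples of `n` labels in `{1, …, N}`. -/
noncomputable def incTuples (n N : ℕ) : Finset (Fin n → Fin N) :=
  open Classical in univ.filter StrictMono

/-- The iterated integral `∫_{a_1}^{b_1} dy_1 ⋯ ∫_{a_n}^{b_n} dy_n F(y_1, …, y_n)`. -/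
noncomputable def iterInt : (n : ℕ) → (a b : Fin n → ℝ) → ((Fin n → ℝ) → ℂ) → ℂ
  | 0, _, _, F => F Fin.elim0
  | n + 1, a, b, F =>
    ∫ y in (a 0)..(b 0), iterInt n (Fin.tail a) (Fin.tail b) fun ys => F (Fin.cons y ys)

/-- The points `x_{i_1 + 1}, …, x_{i_n + 1}, x_1` for `x ∈ ℝ^{N+1}`. -/
def chainPlus {N n : ℕ} (i : Fin n → Fin N) (x : Fin (N + 1) → ℝ) : Fin (n + 1) → ℝ :=
  Fin.snoc (fun m => x (i m).succ) (x 0)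

/-- The points `x_{N+1}, x_{i_1}, …, x_{i_n}` for `x ∈ ℝ^{N+1}`. -/
def chainMinus {N n : ℕ} (i : Fin n → Fin N) (x : Fin (N + 1) → ℝ) : Fin (n + 1) → ℝ :=
  Fin.cons (x (Fin.last N)) (fun m => x (i m).castSucc)

/-- The elementary creation operator `ê^+_{μ;i}`: with `i_{n+1}` standing for the label of `x_1`,
`(ê^+ f)(x) = e^{iμ x_1} θ(x_{i_1+1} > ⋯ > x_{i_n+1} > x_1)
  ∏_m ∫_{x_{i_{m+1}+1}}^{x_{i_m+1}} dy_m e^{iμ (x_{i_m+1} - y_m)} f(z)`,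
where `z` is `(x_2, …, x_{N+1})` with the entry at position `i_m` replaced by `y_m`. -/
noncomputable def elemPlus {N n : ℕ} (μ : ℂ) (i : Fin n → Fin N) (f : (Fin N → ℝ) → ℂ)
    (x : Fin (N + 1) → ℝ) : ℂ :=
  open Classical in
  if StrictAnti (chainPlus i x) then
    Complex.exp (Complex.I * μ * (x 0 : ℂ)) *
      iterInt n (fun m => chainPlus i x m.succ) (fun m => chainPlus i x m.castSucc) fun y =>
        (∏ m, Complex.exp (Complex.I * μ * ((x (i m).succ - y m : ℝ) : ℂ))) *
          f (Function.extend i y (Fin.tail x))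
  else 0

/-- The elementary creation operator `ê^-_{μ;i}`: with `i_0 = N + 1`,
`(ê^- f)(x) = e^{iμ x_{N+1}} θ(x_{N+1} > x_{i_1} > ⋯ > x_{i_n})
  ∏_m ∫_{x_{i_m}}^{x_{i_{m-1}}} dy_m e^{iμ (x_{i_m} - y_m)} f(z)`,
where `z` is `(x_1, …, x_N)` with the entry at position `i_m` replaced by `y_m`. -/
noncomputable def elemMinus {N n : ℕ} (μ : ℂ) (i : Fin n → Fin N) (f : (Fin N → ℝ) → ℂ)
    (x : Fin (N + 1) → ℝ) : ℂ :=
  open Classical in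
  if StrictAnti (chainMinus i x) then
    Complex.exp (Complex.I * μ * (x (Fin.last N) : ℂ)) *
      iterInt n (fun m => chainMinus i x m.succ) (fun m => chainMinus i x m.castSucc) fun y =>
        (∏ m, Complex.exp (Complex.I * μ * ((x (i m).castSucc - y m : ℝ) : ℂ))) *
          f (Function.extend i y (Fin.init x))
  else 0

/-- The non-symmetric creation operator `b^+_μ`. -/
noncomputable def bPlus {N : ℕ} (γ : ℝ) (μ : ℂ) (f : (Fin N → ℝ) → ℂ)
    (x : Fin (N + 1) → ℝ) : ℂ :=
  ∑ n ∈ range (N + 1), (γ : ℂ) ^ n * ∑ i ∈ injTuples n N, elemPlus μ i f x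

/-- The non-symmetric creation operator `b^-_μ`. -/
noncomputable def bMinus {N : ℕ} (γ : ℝ) (μ : ℂ) (f : (Fin N → ℝ) → ℂ)
    (x : Fin (N + 1) → ℝ) : ℂ :=
  ∑ n ∈ range (N + 1), (γ : ℂ) ^ n * ∑ i ∈ injTuples n N, elemMinus μ i f x

/-- The operator `(a^+_μ f)(x) = (b^+_μ f)(x^+, x)` on functions on `J^N`, `J = [x^+, x^-]`.
For `x ∈ J^N` only the values of `f` on `J^N` are used. -/
noncomputable def aPlus {N : ℕ} (γ xp : ℝ) (μ : ℂ) (f : (Fin N → ℝ) → ℂ) (x : Fin N → ℝ) : ℂ :=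
  bPlus γ μ f (Fin.cons xp x)

/-- The operator `(a^-_μ f)(x) = (b^-_μ f)(x, x^-)` on functions on `J^N`, `J = [x^+, x^-]`.
For `x ∈ J^N` only the values of `f` on `J^N` are used. -/
noncomputable def aMinus {N : ℕ} (γ xm : ℝ) (μ : ℂ) (f : (Fin N → ℝ) → ℂ) (x : Fin N → ℝ) : ℂ :=
  bMinus γ μ f (Fin.snoc x xm)

/-- The recursion for the coefficients `a^+`, with an increasing tuple given by the set of its
entries. -/
noncomputable def coeffPlusSet (γ xp : ℝ) : (N : ℕ) → (Fin N → ℂ) → ℂ → Finset (Fin N) → ℂ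
  | 0, _, μ, _ => Complex.exp (Complex.I * μ * (xp : ℂ))
  | N + 1, lam, μ, S =>
    if 0 ∈ S then
      Complex.I * γ / (lam 0 - μ) *
        coeffPlusSet γ xp N (Fin.tail lam) (lam 0) (univ.filter fun j => j.succ ∈ S)
    else
      (lam 0 - μ - Complex.I * γ) / (lam 0 - μ) *
        coeffPlusSet γ xp N (Fin.tail lam) μ (univ.filter fun j => j.succ ∈ S)

/-- The recursion for the coefficients `a^-`, with an increasing tuple given by the set of its
entries. -/
noncomputable def coeffMinusSet (γ xm : ℝ) : (N : ℕ) → (Fin N → ℂ) → ℂ → Finset (Fin N) → ℂ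
  | 0, _, μ, _ => Complex.exp (Complex.I * μ * (xm : ℂ))
  | N + 1, lam, μ, S =>
    if Fin.last N ∈ S then
      -(Complex.I * γ) / (lam (Fin.last N) - μ) *
        coeffMinusSet γ xm N (Fin.init lam) (lam (Fin.last N))
          (univ.filter fun j => j.castSucc ∈ S)
    else
      (lam (Fin.last N) - μ + Complex.I * γ) / (lam (Fin.last N) - μ) *
        coeffMinusSet γ xm N (Fin.init lam) μ (univ.filter fun j => j.castSucc ∈ S)

/-- The coefficient `a^+_i(λ; μ)` of an increasing tuple `i`. -/
noncomputable def coeffPlus {N n : ℕ} (γ xp : ℝ) (lam : Fin N → ℂ) (μ : ℂ)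
    (i : Fin n → Fin N) : ℂ :=
  coeffPlusSet γ xp N lam μ (univ.image i)

/-- The coefficient `a^-_i(λ; μ)` of an increasing tuple `i`. -/
noncomputable def coeffMinus {N n : ℕ} (γ xm : ℝ) (lam : Fin N → ℂ) (μ : ℂ)
    (i : Fin n → Fin N) : ℂ :=
  coeffMinusSet γ xm N lam μ (univ.image i)

/-! The coefficients satisfy the defining recursions in terms of tuples. -/

theorem coeffPlus_empty {n : ℕ} (γ xp : ℝ) (lam : Fin 0 → ℂ) (μ : ℂ) (i : Fin n → Fin 0) :
    coeffPlus γ xp lam μ i = Complex.exp (Complex.I * μ * (xp : ℂ)) := rfl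

theorem coeffPlus_shift {N n : ℕ} (γ xp : ℝ) (lam : Fin (N + 1) → ℂ) (μ : ℂ)
    (i : Fin n → Fin N) :
    coeffPlus γ xp lam μ (fun m => (i m).succ) =
      (lam 0 - μ - Complex.I * γ) / (lam 0 - μ) * coeffPlus γ xp (Fin.tail lam) μ i := by
  simp [coeffPlus, coeffPlusSet, Fin.succ_ne_zero]

theorem coeffPlus_cons {N n : ℕ} (γ xp : ℝ) (lam : Fin (N + 1) → ℂ) (μ : ℂ)
    (i : Fin n → Fin N) :
    coeffPlus γ xp lam μ (Fin.cons 0 fun m => (i m).succ : Fin (n + 1) → Fin (N + 1)) =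
      Complex.I * γ / (lam 0 - μ) * coeffPlus γ xp (Fin.tail lam) (lam 0) i := by
  simp [coeffPlus, coeffPlusSet, Fin.exists_fin_succ]
  left; congr 1; ext; simp [Fin.succ_ne_zero, eq_comm]

theorem coeffMinus_empty {n : ℕ} (γ xm : ℝ) (lam : Fin 0 → ℂ) (μ : ℂ) (i : Fin n → Fin 0) :
    coeffMinus γ xm lam μ i = Complex.exp (Complex.I * μ * (xm : ℂ)) := rfl

theorem coeffMinus_castSucc {N n : ℕ} (γ xm : ℝ) (lam : Fin (N + 1) → ℂ) (μ : ℂ)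
    (i : Fin n → Fin N) :
    coeffMinus γ xm lam μ (fun m => (i m).castSucc) =
      (lam (Fin.last N) - μ + Complex.I * γ) / (lam (Fin.last N) - μ) *
        coeffMinus γ xm (Fin.init lam) μ i := by
  simp [coeffMinus, coeffMinusSet, Fin.castSucc_ne_last]

theorem coeffMinus_snoc {N n : ℕ} (γ xm : ℝ) (lam : Fin (N + 1) → ℂ) (μ : ℂ)
    (i : Fin n → Fin N) :
    coeffMinus γ xm lam μ
        (Fin.snoc (fun m => (i m).castSucc) (Fin.last N) : Fin (n + 1) → Fin (N + 1)) =
      -(Complex.I * γ) / (lam (Fin.last N) - μ) *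
        coeffMinus γ xm (Fin.init lam) (lam (Fin.last N)) i := by
  have h1 : Fin.last N ∈ univ.image
      (Fin.snoc (fun m => (i m).castSucc) (Fin.last N) : Fin (n + 1) → Fin (N + 1)) :=
    mem_image.2 ⟨Fin.last n, mem_univ _, by simp⟩
  rw [coeffMinus, coeffMinusSet, if_pos h1, coeffMinus]
  congr 2
  ext j
  simp [Fin.exists_fin_succ']
  exact fun h => absurd h.symm (Fin.castSucc_ne_last j)

/-- The tuple obtained from `λ` by putting `λ_{i_{m-1}}` at position `i_m` for `m = 1, …, n`, where
`λ_{i_0}` stands for `μ`. -/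
noncomputable def shiftPlus {N n : ℕ} (lam : Fin N → ℂ) (μ : ℂ) (i : Fin n → Fin N) :
    Fin N → ℂ :=
  Function.extend i
    (fun m => (Fin.cons μ (fun k => lam (i k)) : Fin (n + 1) → ℂ) m.castSucc) lam

/-- The tuple obtained from `λ` by putting `λ_{i_{m+1}}` at position `i_m` for `m = 1, …, n`, where
`λ_{i_{n+1}}` stands for `μ`. -/
noncomputable def shiftMinus {N n : ℕ} (lam : Fin N → ℂ) (μ : ℂ) (i : Fin n → Fin N) :
    Fin N → ℂ :=
  Function.extend i
    (fun m => (Fin.snoc (fun k => lam (i k)) μ : Fin (n + 1) → ℂ) m.succ) lam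

/-- The function `∑_n ∑_i a^+_i(λ; μ) ψ_{…, λ_{i_{m-1}} at position i_m, …}`. -/
noncomputable def betheSumPlus {N : ℕ} (γ xp : ℝ) (lam : Fin N → ℂ) (μ : ℂ)
    (x : Fin N → ℝ) : ℂ :=
  ∑ n ∈ range (N + 1), ∑ i ∈ incTuples n N,
    coeffPlus γ xp lam μ i * psi γ (shiftPlus lam μ i) x

/-- The function `∑_n ∑_i a^-_i(λ; μ) ψ_{…, λ_{i_{m+1}} at position i_m, …}`. -/
noncomputable def betheSumMinus {N : ℕ} (γ xm : ℝ) (lam : Fin N → ℂ) (μ : ℂ)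
    (x : Fin N → ℝ) : ℂ :=
  ∑ n ∈ range (N + 1), ∑ i ∈ incTuples n N,
    coeffMinus γ xm lam μ i * psi γ (shiftMinus lam μ i) x

/-- `μ` and the entries of `λ` are pairwise distinct, i.e. all denominators are nonzero. -/
def Generic {N : ℕ} (lam : Fin N → ℂ) (μ : ℂ) : Prop :=
  Function.Injective lam ∧ ∀ j, lam j ≠ μ

end QNLS

/-! The core is the identity $b^+_\mu\psi_{\bm\lambda}=\psi_{(\mu,\bm\lambda)}$ (`bPlus_psi`). It
gives $(a^+_\mu\psi_{\bm\lambda})(\bm x)=\psi_{(\mu,\bm\lambda)}(x^+,\bm x)$, so the theorem becomes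
a statement about one value of an $(N+1)$-particle wavefunction. Since $x^+$ is the smallest
coordinate, it would split off as a factor $e^{i\nu x^+}$ if it stood last (`psi_snoc_of_le`). It is
moved there by the exchange relation `psi_act_swap`, which expresses $\psi_{\bm\lambda}(s_j\bm x)$
through $\psi_{s_j\bm\lambda}(\bm x)$ and $\psi_{\bm\lambda}(\bm x)$. At each crossing there are two
terms: either the travelling parameter goes on with $x^+$, or it stays behind and the parameter it
meets goes on instead. The labels where the second happens form the tuple $\bm i$, and the two
weights are those of the recursion for $a^+_{\bm i}$ (`bethe_expansion`).

The exchange relation rests on well-definedness of $\psi$. On plane waves with distinct parameters,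
$s_j^\gamma$ acts through an operator on functions of the parameters (`simpleRefl_planeWave`,
`specOp`). These operators satisfy the Coxeter relations, so words with the same permutation act
alike (`BraidRel.prod_eq_of_swap_prod_eq`); density and continuity give all parameters. On walls,
the stabilizer is generated by simple transpositions that act trivially there.

For `bPlus_psi`, the wavefunctions satisfy Dunkl-type differential equations (`hasDerivAt_psi`).
Integrating in the first coordinate up to a point above all others gives `psi_cons_integral`;
grouping the terms of $b^+_\mu$ by the last label gives the same integral equation
(`bPlus_cons_integral`). Its right-hand side only involves points with fewer coordinates above the
first one, so induction identifies the two solutions.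

Since $\psi$ is jointly continuous in parameters and coordinates, the left-hand side is continuous
in the parameters, which yields the limits. The case $a^-$ follows by the reflection $\bm
x\mapsto(-x_N,\dots,-x_1)$, with the same reflection of the parameters. -/

namespace QNLS

open Finset

/-! ### Words in a monoid satisfying the braid relations -/

/-- The first `n` entries of `t` satisfy the Coxeter relations of type `A_n`. -/
structure BraidRel {M : Type*} [Monoid M] (n : ℕ) (t : ℕ → M) : Prop where
  sq : ∀ a, a < n → t a * t a = 1
  braid : ∀ a, a + 1 < n → t a * t (a + 1) * t a = t (a + 1) * t a * t (a + 1)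
  comm : ∀ a b, a + 2 ≤ b → b < n → t a * t b = t b * t a

theorem BraidRel.shift {M : Type*} [Monoid M] {n : ℕ} {t : ℕ → M} (h : BraidRel (n + 1) t) :
    BraidRel n fun a => t (a + 1) :=
  ⟨fun a ha => h.sq _ (by omega), fun a ha => h.braid _ (by omega),
    fun a b hab hb => h.comm _ _ (by omega) (by omega)⟩

theorem BraidRel.prod {M M' : Type*} [Monoid M] [Monoid M'] {n : ℕ} {t : ℕ → M} {t' : ℕ → M'}
    (h : BraidRel n t) (h' : BraidRel n t') : BraidRel n fun a => (t a, t' a) :=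
  ⟨fun a ha => Prod.ext (h.sq a ha) (h'.sq a ha),
    fun a ha => Prod.ext (h.braid a ha) (h'.braid a ha),
    fun a b hab hb => Prod.ext (h.comm a b hab hb) (h'.comm a b hab hb)⟩

/-- The descending product `t_{k-1} ⋯ t_0`. -/
def descProd {M : Type*} [Monoid M] (t : ℕ → M) : ℕ → M
  | 0 => 1
  | k + 1 => t k * descProd t k

theorem BraidRel.mul_descProd_of_lt {M : Type*} [Monoid M] {n : ℕ} {t : ℕ → M}
    (h : BraidRel n t) {j : ℕ} (hj : j < n) :
    ∀ k, k < j → t j * descProd t k = descProd t k * t j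
  | 0, _ => by simp [descProd]
  | k + 1, hk => by
    rw [descProd, ← mul_assoc, ← h.comm k j (by omega) hj, mul_assoc,
      h.mul_descProd_of_lt hj k (by omega), mul_assoc]

/-- The letter $t_j$ commutes past $t_{k-1},\dots,t_{j+2}$, turns into $t_{j+1}$ by the braid
relation with $t_{j+1}t_j$, and commutes past the rest. -/
theorem BraidRel.mul_descProd_of_gt {M : Type*} [Monoid M] {n : ℕ} {t : ℕ → M}
    (h : BraidRel n t) {j : ℕ} :
    ∀ k, j + 2 ≤ k → k ≤ n → t j * descProd t k = descProd t k * t (j + 1)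
  | 0, hk, _ => by omega
  | k + 1, hk, hn => by
    rcases Nat.lt_or_ge (j + 1) k with hjk | hjk
    · rw [descProd, ← mul_assoc, h.comm j k (by omega) (by omega), mul_assoc,
        h.mul_descProd_of_gt k (by omega) (by omega), mul_assoc]
    · obtain rfl : k = j + 1 := by omega
      rw [descProd, descProd, ← mul_assoc, ← mul_assoc, h.braid j (by omega), mul_assoc,
        h.mul_descProd_of_lt (by omega) j (by omega), ← mul_assoc, ← mul_assoc]

/-- This is the coset decomposition of $S_{n+2}$ modulo the stabilizer of the first point, proved
from the relations alone: the products on the right are stable under left multiplication by any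
$t_j$. -/
theorem BraidRel.exists_normalForm {M : Type*} [Monoid M] {n : ℕ} {t : ℕ → M}
    (h : BraidRel (n + 1) t) (l : List ℕ) (hl : ∀ a ∈ l, a < n + 1) :
    ∃ k ≤ n + 1, ∃ l' : List ℕ, (∀ a ∈ l', a < n) ∧
      (l.map t).prod = descProd t k * (l'.map fun a => t (a + 1)).prod := by
  induction l with
  | nil => exact ⟨0, by omega, [], by simp, by simp [descProd]⟩
  | cons j l ih =>
    obtain ⟨k, hk, l', hl', e⟩ := ih fun a ha => hl a (by simp [ha])
    have hj : j < n + 1 := hl j (by simp)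
    simp only [List.map_cons, List.prod_cons, e]
    rcases lt_trichotomy j k with hjk | rfl | hjk
    · rcases Nat.lt_or_ge (j + 1) k with hjk' | hjk'
      · refine ⟨k, hk, j :: l', ?_, ?_⟩
        · simpa using ⟨by omega, hl'⟩
        · rw [← mul_assoc, h.mul_descProd_of_gt k (by omega) hk]
          simp [mul_assoc]
      · obtain rfl : k = j + 1 := by omega
        refine ⟨j, by omega, l', hl', ?_⟩
        rw [descProd, ← mul_assoc, ← mul_assoc, h.sq j hj, one_mul]
    · exact ⟨j + 1, by omega, l', hl', by rw [descProd, mul_assoc]⟩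
    · obtain ⟨j, rfl⟩ : ∃ i, j = i + 1 := ⟨j - 1, by omega⟩
      refine ⟨k, hk, j :: l', ?_, ?_⟩
      · simpa using ⟨by omega, hl'⟩
      · rw [← mul_assoc, h.mul_descProd_of_lt hj k hjk]
        simp [mul_assoc]

/-! ### Coxeter relations for transpositions and the word problem -/

theorem swap_braid {α : Type*} [DecidableEq α] {a b c : α} (hab : a ≠ b) (hac : a ≠ c)
    (hbc : b ≠ c) :
    Equiv.swap a b * Equiv.swap b c * Equiv.swap a b =
      Equiv.swap b c * Equiv.swap a b * Equiv.swap b c := by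
  rw [Equiv.swap_mul_swap_mul_swap hab hac, Equiv.swap_comm a b, Equiv.swap_comm b c,
    Equiv.swap_mul_swap_mul_swap hbc.symm hac.symm, Equiv.swap_comm]

theorem swap_comm_swap {α : Type*} [DecidableEq α] {a b c d : α} (hac : a ≠ c) (had : a ≠ d)
    (hbc : b ≠ c) (hbd : b ≠ d) :
    Equiv.swap a b * Equiv.swap c d = Equiv.swap c d * Equiv.swap a b := by
  rw [Equiv.mul_swap_eq_swap_mul, Equiv.swap_apply_of_ne_of_ne hac.symm hbc.symm,
    Equiv.swap_apply_of_ne_of_ne had.symm hbd.symm]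

theorem braidRel_swap (m n : ℕ) :
    BraidRel n fun a => (Equiv.swap (a + m) (a + m + 1) : Equiv.Perm ℕ) :=
  ⟨fun a _ => Equiv.swap_mul_self _ _,
    fun a _ => by
      rw [show a + 1 + m = a + m + 1 by omega]
      exact swap_braid (by omega) (by omega) (by omega),
    fun a b hab _ => swap_comm_swap (by omega) (by omega) (by omega) (by omega)⟩

/-- The image of the first point recovers $k$, which makes the normal form unique. -/
theorem descProd_swap_apply (m : ℕ) : ∀ k,
    descProd (fun a => (Equiv.swap (a + m) (a + m + 1) : Equiv.Perm ℕ)) k m = k + m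
  | 0 => by simp [descProd]
  | k + 1 => by
    rw [descProd, Equiv.Perm.mul_apply, descProd_swap_apply m k, Equiv.swap_apply_left]
    omega

theorem prod_swap_apply_of_lt (m : ℕ) (l : List ℕ) :
    (l.map fun a => (Equiv.swap (a + (m + 1)) (a + (m + 1) + 1) : Equiv.Perm ℕ)).prod m = m := by
  induction l with
  | nil => rfl
  | cons a l ih =>
    rw [List.map_cons, List.prod_cons, Equiv.Perm.mul_apply, ih,
      Equiv.swap_apply_of_ne_of_ne (by omega) (by omega)]

theorem descProd_prod {M M' : Type*} [Monoid M] [Monoid M'] (t : ℕ → M) (t' : ℕ → M') : ∀ k,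
    descProd (fun a => (t a, t' a)) k = (descProd t k, descProd t' k)
  | 0 => rfl
  | k + 1 => by simp [descProd, descProd_prod t t' k]

theorem list_prod_prod {M M' : Type*} [Monoid M] [Monoid M'] (t : ℕ → M) (t' : ℕ → M')
    (l : List ℕ) :
    (l.map fun a => (t a, t' a)).prod = ((l.map t).prod, (l.map t').prod) := by
  induction l with
  | nil => rfl
  | cons a l ih => simp [ih]

/-- The product of a word in elements satisfying the Coxeter relations of type `A_n` depends only
on the corresponding permutation. -/
theorem BraidRel.prod_eq_of_swap_prod_eq {M : Type*} [Monoid M] (n : ℕ) :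
    ∀ (m : ℕ) (t : ℕ → M), BraidRel n t → ∀ l l' : List ℕ, (∀ a ∈ l, a < n) → (∀ a ∈ l', a < n) →
      (l.map fun a => (Equiv.swap (a + m) (a + m + 1) : Equiv.Perm ℕ)).prod =
        (l'.map fun a => (Equiv.swap (a + m) (a + m + 1) : Equiv.Perm ℕ)).prod →
      (l.map t).prod = (l'.map t).prod := by
  induction n with
  | zero =>
    intro m t _ l l' hl hl' _
    rw [List.eq_nil_iff_forall_not_mem.2 fun a ha => absurd (hl a ha) (by omega),
      List.eq_nil_iff_forall_not_mem.2 fun a ha => absurd (hl' a ha) (by omega)]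
  | succ n ih =>
    intro m t ht l l' hl hl' e
    -- Normalizing in the product monoid gives one and the same normal form for the word in $t$ and
    -- for its permutation.
    have hp := ht.prod (braidRel_swap m (n + 1))
    obtain ⟨k, hk, w, hw, h1⟩ := hp.exists_normalForm l hl
    obtain ⟨k', hk', w', hw', h1'⟩ := hp.exists_normalForm l' hl'
    simp only [list_prod_prod, descProd_prod, Prod.mk_mul_mk, Prod.mk.injEq] at h1 h1'
    have s : ∀ a, a + 1 + m = a + (m + 1) := fun a => by omega
    simp only [s] at h1 h1'
    obtain ⟨h1, h2⟩ := h1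
    obtain ⟨h1', h2'⟩ := h1'
    rw [h2, h2'] at e
    -- Both permutations are evaluated at $m$, which the remaining letters fix.
    have ek : k = k' := by
      have := congrArg (fun σ : Equiv.Perm ℕ => σ m) e
      simp only [Equiv.Perm.mul_apply, prod_swap_apply_of_lt, descProd_swap_apply] at this
      omega
    subst ek
    rw [h1, h1', ih (m + 1) _ ht.shift w w' hw hw' (mul_left_cancel e)]

theorem viaEmbedding_swap {α β : Type*} [DecidableEq α] [DecidableEq β] (ι : α ↪ β) (a b : α) :
    (Equiv.swap a b).viaEmbedding ι = Equiv.swap (ι a) (ι b) := by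
  ext x
  by_cases hx : x ∈ Set.range ι
  · obtain ⟨y, rfl⟩ := hx
    rw [Equiv.Perm.viaEmbedding_apply, ι.injective.swap_apply]
  · rw [Equiv.Perm.viaEmbedding_apply_of_notMem _ _ _ hx, Equiv.swap_apply_of_ne_of_ne]
    · rintro rfl; exact hx ⟨a, rfl⟩
    · rintro rfl; exact hx ⟨b, rfl⟩

theorem Adj.lt {N : ℕ} (a : Adj N) : (a.1.1 : ℕ) < N - 1 := by
  have := a.2
  have := a.1.2.2
  omega

/-- The word problem is solved in permutations of `ℕ`, where labels can be shifted during the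
induction; this transfers it to `Fin N`. -/
theorem prod_swap_eq_viaEmbedding {N : ℕ} (l : List (Adj N)) :
    ((l.map fun a => (a.1.1 : ℕ)).map
      fun a => (Equiv.swap (a + 0) (a + 0 + 1) : Equiv.Perm ℕ)).prod =
      Equiv.Perm.viaEmbeddingHom Fin.valEmbedding (wordPerm l) := by
  induction l with
  | nil => simp [wordPerm]
  | cons a l ih =>
    have e : wordPerm (a :: l) = Equiv.swap a.1.1 a.1.2 * wordPerm l := by simp [wordPerm]
    rw [List.map_cons, List.map_cons, List.prod_cons, ih, e, map_mul, Equiv.Perm.viaEmbeddingHom_apply (Equiv.swap _ _), viaEmbedding_swap]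
    simp [a.2]

/-! ### The action on spectral parameters -/

/-- The operator through which the integral-reflection operator of two labels acts on plane waves
with distinct spectral parameters. -/
noncomputable def specOp {N : ℕ} (γ : ℝ) (a b : Fin N)
    (φ : {lam : Fin N → ℂ // Function.Injective lam} → ℂ)
    (lam : {lam : Fin N → ℂ // Function.Injective lam}) : ℂ :=
  (1 + Complex.I * γ / (lam.1 a - lam.1 b)) *
      φ ⟨lam.1 ∘ Equiv.swap a b, lam.2.comp (Equiv.swap a b).injective⟩ -
    Complex.I * γ / (lam.1 a - lam.1 b) * φ lam

/-- With $c=i\gamma/(\lambda_a-\lambda_b)$, which changes sign under the swap, this is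
$(1+c)(1-c)+c^2=1$; the coefficients of the swapped value cancel. -/
theorem specOp_sq {N : ℕ} (γ : ℝ) {a b : Fin N} (hab : a ≠ b)
    (φ : {lam : Fin N → ℂ // Function.Injective lam} → ℂ) :
    specOp γ a b (specOp γ a b φ) = φ := by
  ext ⟨lam, h⟩
  have h1 : lam a - lam b ≠ 0 := sub_ne_zero.2 (h.ne hab)
  have h2 : lam b - lam a ≠ 0 := sub_ne_zero.2 (h.ne hab.symm)
  have e : (lam ∘ Equiv.swap a b) ∘ Equiv.swap a b = lam := by ext; simp
  simp only [specOp, Function.comp_apply, Equiv.swap_apply_left, Equiv.swap_apply_right, e]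
  rw [← neg_sub (lam a) (lam b)] at *
  field_simp
  ring

theorem specOp_comm {N : ℕ} (γ : ℝ) {a b c d : Fin N} (hac : a ≠ c) (had : a ≠ d)
    (hbc : b ≠ c) (hbd : b ≠ d)
    (φ : {lam : Fin N → ℂ // Function.Injective lam} → ℂ) :
    specOp γ a b (specOp γ c d φ) = specOp γ c d (specOp γ a b φ) := by
  ext ⟨lam, h⟩
  have e : (lam ∘ Equiv.swap a b) ∘ Equiv.swap c d = (lam ∘ Equiv.swap c d) ∘ Equiv.swap a b := by
    have := swap_comm_swap hac had hbc hbd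
    rw [Function.comp_assoc, Function.comp_assoc, ← Equiv.Perm.coe_mul, this, Equiv.Perm.coe_mul]
  simp only [specOp, Function.comp_apply, e, Equiv.swap_apply_of_ne_of_ne hac had,
    Equiv.swap_apply_of_ne_of_ne hbc hbd, Equiv.swap_apply_of_ne_of_ne hac.symm hbc.symm,
    Equiv.swap_apply_of_ne_of_ne had.symm hbd.symm]
  ring

theorem specOp_braid {N : ℕ} (γ : ℝ) {a b c : Fin N} (hab : a ≠ b) (hac : a ≠ c) (hbc : b ≠ c)
    (φ : {lam : Fin N → ℂ // Function.Injective lam} → ℂ) :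
    specOp γ a b (specOp γ b c (specOp γ a b φ)) =
      specOp γ b c (specOp γ a b (specOp γ b c φ)) := by
  ext ⟨lam, h⟩
  have h1 : lam a - lam b ≠ 0 := sub_ne_zero.2 (h.ne hab)
  have h2 : lam a - lam c ≠ 0 := sub_ne_zero.2 (h.ne hac)
  have h3 : lam b - lam c ≠ 0 := sub_ne_zero.2 (h.ne hbc)
  have e : ((lam ∘ Equiv.swap a b) ∘ Equiv.swap b c) ∘ Equiv.swap a b =
      ((lam ∘ Equiv.swap b c) ∘ Equiv.swap a b) ∘ Equiv.swap b c := by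
    have := swap_braid hab hac hbc
    simp only [Function.comp_assoc]
    rw [← Equiv.Perm.coe_mul, ← Equiv.Perm.coe_mul, ← mul_assoc, this]
    rfl
  have e1 : (lam ∘ Equiv.swap a b) ∘ Equiv.swap a b = lam := by ext; simp
  have e2 : (lam ∘ Equiv.swap b c) ∘ Equiv.swap b c = lam := by ext; simp
  simp only [specOp, Function.comp_apply, e, e1, e2, Equiv.swap_apply_left,
    Equiv.swap_apply_right, Equiv.swap_apply_of_ne_of_ne hab hac,
    Equiv.swap_apply_of_ne_of_ne hac.symm hbc.symm]
  -- Only the values of `φ` at the six rearrangements of the three parameters occur. Treated as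
  -- unknowns, they leave an identity of rational functions in two differences.
  generalize φ _ = f1
  generalize φ _ = f2
  generalize φ _ = f3
  generalize φ _ = f4
  generalize φ _ = f5
  generalize φ _ = f6
  rw [← neg_sub (lam b) (lam c), ← neg_sub (lam a) (lam b)]
  have hs : lam a - lam c = (lam a - lam b) + (lam b - lam c) := by ring
  rw [hs] at h2 ⊢
  generalize lam a - lam b = d1 at *
  generalize lam b - lam c = d2 at *
  simp only [div_neg]
  field_simp
  ring

/-! ### Integral-reflection operators on plane waves -/

/-- The parameter space `X` later holds the spectral parameters: joint continuity is what the
density argument and the limits need. -/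
theorem continuous_simpleRefl {N : ℕ} (γ : ℝ) (a : Adj N) {X : Type*} [TopologicalSpace X]
    [FirstCountableTopology X] {F : X → (Fin N → ℝ) → ℂ}
    (hF : Continuous fun p : X × (Fin N → ℝ) => F p.1 p.2) :
    Continuous fun p : X × (Fin N → ℝ) => simpleRefl γ a (F p.1) p.2 := by
  unfold simpleRefl intOp
  refine Continuous.add ?_ (continuous_const.mul ?_)
  · refine hF.comp (f := fun p : X × (Fin N → ℝ) =>
      (p.1, act (Equiv.swap a.1.1 a.1.2)⁻¹ p.2)) ?_
    unfold act
    fun_prop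
  · refine intervalIntegral.continuous_parametric_intervalIntegral_of_continuous
      (f := fun (p : X × (Fin N → ℝ)) (y : ℝ) => F p.1
        (p.2 - y • ((Pi.single a.1.1 1 : Fin N → ℝ) - (Pi.single a.1.2 1 : Fin N → ℝ)))) ?_ ?_
    · exact hF.comp (f := fun q : (X × (Fin N → ℝ)) × ℝ => (q.1.1,
        q.1.2 - q.2 • ((Pi.single a.1.1 1 : Fin N → ℝ) - (Pi.single a.1.2 1 : Fin N → ℝ))))
        (by fun_prop)
    · fun_prop

theorem continuous_wordRefl {N : ℕ} (γ : ℝ) (l : List (Adj N)) {X : Type*} [TopologicalSpace X]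
    [FirstCountableTopology X] {F : X → (Fin N → ℝ) → ℂ}
    (hF : Continuous fun p : X × (Fin N → ℝ) => F p.1 p.2) :
    Continuous fun p : X × (Fin N → ℝ) => wordRefl γ l (F p.1) p.2 := by
  induction l with
  | nil => exact hF
  | cons a l ih => exact continuous_simpleRefl γ a (F := fun p => wordRefl γ l (F p)) ih

theorem simpleRefl_continuous {N : ℕ} (γ : ℝ) (a : Adj N) {f : (Fin N → ℝ) → ℂ}
    (hf : Continuous f) : Continuous (simpleRefl γ a f) :=
  (continuous_simpleRefl γ a (X := Unit) (F := fun _ => f) (hf.comp continuous_snd)).comp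
    (Continuous.prodMk (continuous_const (y := ())) continuous_id)

theorem wordRefl_continuous {N : ℕ} (γ : ℝ) (l : List (Adj N)) {f : (Fin N → ℝ) → ℂ}
    (hf : Continuous f) : Continuous (wordRefl γ l f) := by
  induction l with
  | nil => exact hf
  | cons a l ih => exact simpleRefl_continuous γ a ih

theorem continuous_planeWave {N : ℕ} :
    Continuous fun p : (Fin N → ℂ) × (Fin N → ℝ) => planeWave p.1 p.2 := by
  unfold planeWave
  fun_prop

theorem simpleRefl_linear {N : ℕ} (γ : ℝ) (a : Adj N) {f g : (Fin N → ℝ) → ℂ}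
    (hf : Continuous f) (hg : Continuous g) (c d : ℂ) :
    simpleRefl γ a (c • f + d • g) = c • simpleRefl γ a f + d • simpleRefl γ a g := by
  ext x
  simp only [simpleRefl, intOp, Pi.add_apply, Pi.smul_apply, smul_eq_mul]
  rw [intervalIntegral.integral_add, intervalIntegral.integral_const_mul,
    intervalIntegral.integral_const_mul]
  · ring
  all_goals exact Continuous.intervalIntegrable (by fun_prop) _ _

theorem wordRefl_linear {N : ℕ} (γ : ℝ) (l : List (Adj N)) {f g : (Fin N → ℝ) → ℂ}
    (hf : Continuous f) (hg : Continuous g) (c d : ℂ) :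
    wordRefl γ l (c • f + d • g) = c • wordRefl γ l f + d • wordRefl γ l g := by
  induction l with
  | nil => rfl
  | cons a l ih =>
    change simpleRefl γ a (wordRefl γ l _) = _
    rw [ih, simpleRefl_linear γ a (wordRefl_continuous γ l hf) (wordRefl_continuous γ l hg)]
    rfl

theorem Adj.ne {N : ℕ} (a : Adj N) : a.1.1 ≠ a.1.2 := fun h => by
  have := a.2
  rw [h] at this
  omega

theorem planeWave_act_swap {N : ℕ} (a b : Fin N) (lam : Fin N → ℂ) (x : Fin N → ℝ) :
    planeWave lam (act (Equiv.swap a b)⁻¹ x) = planeWave (lam ∘ Equiv.swap a b) x := by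
  unfold planeWave act
  congr 2
  rw [← Equiv.sum_comp (Equiv.swap a b)]
  simp

/-- Along $\bm e_a-\bm e_b$ a plane wave is a pure exponential. Its integral up to $x_a-x_b$ is the
difference of the swapped and the original wave, divided by $-i(\lambda_a-\lambda_b)$. -/
theorem simpleRefl_planeWave {N : ℕ} (γ : ℝ) (a : Adj N) {lam : Fin N → ℂ}
    (h : lam a.1.1 ≠ lam a.1.2) :
    simpleRefl γ a (planeWave lam) =
      (1 + Complex.I * γ / (lam a.1.1 - lam a.1.2)) • planeWave (lam ∘ Equiv.swap a.1.1 a.1.2) +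
        (-(Complex.I * γ / (lam a.1.1 - lam a.1.2))) • planeWave lam := by
  ext x
  have hne := a.ne
  obtain ⟨⟨a, b⟩, hab⟩ := a
  simp only at h hne ⊢
  have hd : lam a - lam b ≠ 0 := sub_ne_zero.2 h
  have e1 : ∀ y : ℝ, planeWave lam
      (x - y • ((Pi.single a 1 : Fin N → ℝ) - (Pi.single b 1 : Fin N → ℝ))) =
        planeWave lam x * Complex.exp (-(Complex.I * (lam a - lam b)) * y) := by
    intro y
    unfold planeWave
    rw [← Complex.exp_add]
    congr 1
    have : ∑ j, lam j * ((x - y • ((Pi.single a 1 : Fin N → ℝ) - (Pi.single b 1 : Fin N → ℝ))) j : ℝ)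
        = ∑ j, (lam j * x j - (y * lam j * (Pi.single a 1 : Fin N → ℂ) j
          - y * lam j * (Pi.single b 1 : Fin N → ℂ) j)) := by
      refine Finset.sum_congr rfl fun j _ => ?_
      have e : ∀ c : Fin N, (((Pi.single c 1 : Fin N → ℝ) j : ℝ) : ℂ) = (Pi.single c 1 : Fin N → ℂ) j := by
        intro c
        by_cases hc : j = c
        · subst hc; simp
        · simp [hc]
      simp only [Pi.sub_apply, Pi.smul_apply, smul_eq_mul]
      push_cast
      rw [e, e]
      ring
    rw [this, Finset.sum_sub_distrib, Finset.sum_sub_distrib]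
    simp only [Pi.single_apply, mul_ite, mul_one, mul_zero, Finset.sum_ite_eq', Finset.mem_univ, if_true]
    ring
  have e2 : planeWave (lam ∘ Equiv.swap a b) x =
      planeWave lam x * Complex.exp (-(Complex.I * (lam a - lam b)) * (x a - x b : ℝ)) := by
    rw [← e1, ← planeWave_act_swap]
    congr 1
    ext j
    by_cases hja : j = a
    · subst hja; simp [act, hne]
    by_cases hjb : j = b
    · subst hjb; simp [act, hne.symm]
    simp [act, hja, hjb, Equiv.swap_apply_of_ne_of_ne]
  simp only [simpleRefl, intOp, planeWave_act_swap, Pi.add_apply, Pi.smul_apply, smul_eq_mul]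
  simp only [e1]
  have hc : -(Complex.I * (lam a - lam b)) ≠ 0 := neg_ne_zero.2 (mul_ne_zero Complex.I_ne_zero hd)
  rw [intervalIntegral.integral_const_mul, integral_exp_mul_complex hc, e2]
  simp only [Complex.ofReal_zero, mul_zero, Complex.exp_zero]
  generalize Complex.exp _ = E
  have hI := Complex.I_sq
  field_simp
  linear_combination (-(γ : ℂ) * planeWave lam x * (E - 1)) * hI

theorem wordRefl_append_singleton {N : ℕ} (γ : ℝ) (l : List (Adj N)) (a : Adj N)
    (f : (Fin N → ℝ) → ℂ) : wordRefl γ (l ++ [a]) f = wordRefl γ l (simpleRefl γ a f) := by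
  simp [wordRefl]

theorem wordRefl_concat_planeWave {N : ℕ} (γ : ℝ) (l : List (Adj N)) (a : Adj N)
    {lam : Fin N → ℂ} (h : lam a.1.1 ≠ lam a.1.2) (x : Fin N → ℝ) :
    wordRefl γ (l ++ [a]) (planeWave lam) x =
      (1 + Complex.I * γ / (lam a.1.1 - lam a.1.2)) *
        wordRefl γ l (planeWave (lam ∘ Equiv.swap a.1.1 a.1.2)) x -
      Complex.I * γ / (lam a.1.1 - lam a.1.2) * wordRefl γ l (planeWave lam) x := by
  have hc : ∀ lam : Fin N → ℂ, Continuous (planeWave lam) := fun lam =>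
    continuous_planeWave.comp (Continuous.prodMk continuous_const continuous_id)
  rw [wordRefl_append_singleton, simpleRefl_planeWave γ a h, wordRefl_linear γ l (hc _) (hc _)]
  simp only [Pi.add_apply, Pi.smul_apply, smul_eq_mul]
  ring

/-- The operators `specOp` of neighbouring labels, as a sequence in a monoid. -/
noncomputable def specGen (N : ℕ) (γ : ℝ) (a : ℕ) :
    Function.End ({lam : Fin N → ℂ // Function.Injective lam} → ℂ) :=
  if h : a + 1 < N then specOp γ ⟨a, by omega⟩ ⟨a + 1, h⟩ else 1

theorem specGen_apply {N : ℕ} (γ : ℝ) {a : ℕ} (h : a + 1 < N)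
    (φ : {lam : Fin N → ℂ // Function.Injective lam} → ℂ) :
    specGen N γ a φ = specOp γ ⟨a, by omega⟩ ⟨a + 1, h⟩ φ := by
  exact congrFun (dif_pos h) φ

theorem braidRel_specGen (N : ℕ) (γ : ℝ) : BraidRel (N - 1) (specGen N γ) := by
  refine ⟨fun a ha => funext fun φ => ?_, fun a ha => funext fun φ => ?_,
    fun a b hab hb => funext fun φ => ?_⟩
  · have h : a + 1 < N := by omega
    change specGen N γ a (specGen N γ a φ) = φ
    rw [specGen_apply γ h, specGen_apply γ h]
    exact specOp_sq γ (by simp) φ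
  · have h : a + 1 < N := by omega
    have h' : a + 1 + 1 < N := by omega
    change specGen N γ a (specGen N γ (a + 1) (specGen N γ a φ)) =
      specGen N γ (a + 1) (specGen N γ a (specGen N γ (a + 1) φ))
    simp only [specGen_apply γ h, specGen_apply γ h']
    exact specOp_braid γ (by simp) (by simp; omega) (by simp) φ
  · have h : a + 1 < N := by omega
    have h' : b + 1 < N := by omega
    change specGen N γ a (specGen N γ b φ) = specGen N γ b (specGen N γ a φ)
    simp only [specGen_apply γ h, specGen_apply γ h']
    exact specOp_comm γ (by simp; omega) (by simp; omega) (by simp; omega) (by simp; omega) φ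

/-- The word is reversed because the last letter hits the plane wave first, so that in terms of the
parameters it becomes the outermost operator. -/
theorem wordRefl_planeWave_eq {N : ℕ} (γ : ℝ) (l : List (Adj N)) (x : Fin N → ℝ)
    (lam : {lam : Fin N → ℂ // Function.Injective lam}) :
    wordRefl γ l (planeWave lam.1) x =
      ((l.reverse.map fun a => (a.1.1 : ℕ)).map (specGen N γ)).prod
        (fun lam => planeWave lam.1 x) lam := by
  induction l using List.reverseRecOn generalizing lam with
  | nil => rfl
  | append_singleton l a ih =>
    have hlt := a.lt
    have hb : (⟨(a.1.1 : ℕ) + 1, by omega⟩ : Fin N) = a.1.2 := Fin.ext a.2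
    rw [wordRefl_concat_planeWave γ l a (lam.2.ne a.ne)]
    rw [List.reverse_append, List.reverse_singleton, List.singleton_append, List.map_cons,
      List.map_cons, List.prod_cons]
    rw [ih lam, ih ⟨lam.1 ∘ Equiv.swap a.1.1 a.1.2, lam.2.comp (Equiv.swap _ _).injective⟩]
    generalize (List.map (specGen N γ) _).prod = Q
    change _ = specGen N γ a.1.1 (Q _) lam
    rw [specGen_apply γ (by omega : (a.1.1 : ℕ) + 1 < N), hb]
    rfl

theorem wordPerm_append {N : ℕ} (l l' : List (Adj N)) :
    wordPerm (l ++ l') = wordPerm l * wordPerm l' := by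
  simp [wordPerm]

theorem wordPerm_reverse {N : ℕ} (l : List (Adj N)) : wordPerm l.reverse = (wordPerm l)⁻¹ := by
  simp only [wordPerm, List.prod_inv_reverse, List.map_reverse, List.map_map]
  congr 2

theorem wordRefl_planeWave_eq_of_injective {N : ℕ} (γ : ℝ) {l l' : List (Adj N)}
    (h : wordPerm l = wordPerm l') {lam : Fin N → ℂ} (hlam : Function.Injective lam)
    (x : Fin N → ℝ) :
    wordRefl γ l (planeWave lam) x = wordRefl γ l' (planeWave lam) x := by
  rw [wordRefl_planeWave_eq γ l x ⟨lam, hlam⟩, wordRefl_planeWave_eq γ l' x ⟨lam, hlam⟩]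
  rw [(braidRel_specGen N γ).prod_eq_of_swap_prod_eq (N - 1) 0 _ _ _ ?_ ?_ ?_]
  · rintro a ha
    obtain ⟨b, _, rfl⟩ := List.mem_map.1 ha
    exact b.lt
  · rintro a ha
    obtain ⟨b, _, rfl⟩ := List.mem_map.1 ha
    exact b.lt
  · rw [prod_swap_eq_viaEmbedding, prod_swap_eq_viaEmbedding, wordPerm_reverse, wordPerm_reverse, h]

/-! ### From distinct to arbitrary spectral parameters -/

/-- On the line $\lambda_j+tj$, two entries coincide for all $t\neq0$ or for at most one such $t$,
and the first is excluded by distinct slopes. Hence all small $t\ne0$ give distinct entries. -/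
theorem dense_injective (N : ℕ) : Dense {lam : Fin N → ℂ | Function.Injective lam} := by
  intro lam
  have hc : Filter.Tendsto (fun t : ℂ => fun j : Fin N => lam j + t * (j : ℕ))
      (nhdsWithin 0 {0}ᶜ) (nhds lam) := by
    have : Continuous fun t : ℂ => fun j : Fin N => lam j + t * (j : ℕ) := by fun_prop
    have h := (this.tendsto 0).mono_left (nhdsWithin_le_nhds (s := {0}ᶜ))
    simpa using h
  refine mem_closure_of_tendsto hc ?_
  have hfin : ({t : ℂ | ∃ j k : Fin N, j ≠ k ∧ t = (lam k - lam j) / ((j : ℕ) - (k : ℕ) : ℂ)}).Finite := by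
    refine (Set.finite_range fun p : Fin N × Fin N =>
      (lam p.2 - lam p.1) / ((p.1 : ℕ) - (p.2 : ℕ) : ℂ)).subset ?_
    rintro t ⟨j, k, _, rfl⟩
    exact ⟨(j, k), rfl⟩
  have h0 := (hfin.subset (Set.sdiff_subset (t := {0}))).isClosed.isOpen_compl.mem_nhds
    (show (0 : ℂ) ∉ _ by simp)
  filter_upwards [nhdsWithin_le_nhds h0, self_mem_nhdsWithin] with t ht ht0 j k hjk
  by_contra hne
  refine ht ⟨⟨j, k, hne, ?_⟩, ht0⟩
  have : ((j : ℕ) - (k : ℕ) : ℂ) ≠ 0 := sub_ne_zero.2 fun h => hne (Fin.ext (by exact_mod_cast h))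
  simp only at hjk
  rw [eq_div_iff this]
  linear_combination hjk

theorem eq_of_eq_on_injective {N : ℕ} {F G : (Fin N → ℂ) → ℂ} (hF : Continuous F)
    (hG : Continuous G) (h : ∀ lam, Function.Injective lam → F lam = G lam) (lam : Fin N → ℂ) :
    F lam = G lam :=
  congrFun (hF.ext_on (dense_injective N) hG h) lam

theorem wordRefl_planeWave_congr {N : ℕ} (γ : ℝ) {l l' : List (Adj N)}
    (h : wordPerm l = wordPerm l') (lam : Fin N → ℂ) (x : Fin N → ℝ) :
    wordRefl γ l (planeWave lam) x = wordRefl γ l' (planeWave lam) x :=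
  eq_of_eq_on_injective
    ((continuous_wordRefl γ l continuous_planeWave).comp (Continuous.prodMk continuous_id continuous_const))
    ((continuous_wordRefl γ l' continuous_planeWave).comp (Continuous.prodMk continuous_id continuous_const))
    (fun _ hlam => wordRefl_planeWave_eq_of_injective γ h hlam x) lam

/-! ### The wavefunction does not depend on the sorting permutation -/

theorem act_one {N : ℕ} (x : Fin N → ℝ) : act 1 x = x := by
  ext; simp [act]

theorem act_mul {N : ℕ} (v w : Equiv.Perm (Fin N)) (x : Fin N → ℝ) :
    act (v * w) x = act v (act w x) := by
  ext; simp [act]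

theorem act_inv_act {N : ℕ} (w : Equiv.Perm (Fin N)) (x : Fin N → ℝ) : act w⁻¹ (act w x) = x := by
  rw [← act_mul, inv_mul_cancel, act_one]

theorem act_swap_of_eq {N : ℕ} {a b : Fin N} {z : Fin N → ℝ} (h : z a = z b) :
    act (Equiv.swap a b) z = z := by
  ext j
  rw [act, Equiv.swap_inv, Equiv.swap_apply_def]
  split_ifs with h1 h2
  · rw [h1, h]
  · rw [h2, h]
  · rfl

/-- The stabilizer of a decreasing sequence is generated by simple transpositions. -/
theorem stabilizer_induction {N : ℕ} {z : Fin N → ℝ} (hz : Antitone z)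
    {P : Equiv.Perm (Fin N) → Prop} (one : P 1)
    (step : ∀ (a : Adj N) u, z a.1.1 = z a.1.2 → P u → P (Equiv.swap a.1.1 a.1.2 * u))
    (u : Equiv.Perm (Fin N)) (hu : act u z = z) : P u := by
  -- Removing a descent of $u^{-1}$ strictly increases $\sum_j j\,u^{-1}(j)$, which is at most
  -- $N^3$; the difference is the induction measure.
  have key : ∀ n : ℕ, ∀ u : Equiv.Perm (Fin N), act u z = z →
      (N * N * N - ∑ j : Fin N, (j : ℕ) * (u⁻¹ j : ℕ)) = n → P u := by
    intro n
    induction n using Nat.strong_induction_on with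
    | _ n ih =>
    intro u hu hn
    by_cases hmono : ∀ a : Adj N, u⁻¹ a.1.1 < u⁻¹ a.1.2
    · have : StrictMono (⇑u⁻¹) := by
        cases N with
        | zero => exact Subsingleton.strictMono _
        | succ N =>
          exact Fin.strictMono_iff_lt_succ.2 fun i => hmono ⟨(i.castSucc, i.succ), by simp⟩
      have h1 : u⁻¹ = 1 := by
        ext j
        exact congrArg Fin.val (congrFun ((StrictMono.range_inj this strictMono_id).1 (by
          rw [Set.range_id]; exact (u⁻¹).surjective.range_eq)) j)
      rw [inv_eq_one.1 h1]
      exact one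
    · push Not at hmono
      obtain ⟨a, ha⟩ := hmono
      have hlt : u⁻¹ a.1.2 < u⁻¹ a.1.1 := lt_of_le_of_ne ha fun h => a.ne ((u⁻¹).injective h.symm)
      -- As `u` fixes `z`, a descent of $u^{-1}$ gives the inequality opposite to the one from
      -- monotonicity of `z`.
      have hza : z a.1.1 = z a.1.2 := by
        refine le_antisymm ?_ (hz (Fin.le_def.2 (by have := a.2; omega)))
        have h1 := congrFun hu a.1.1
        have h2 := congrFun hu a.1.2
        rw [← h1, ← h2]
        exact hz ha
      have e : u = Equiv.swap a.1.1 a.1.2 * (Equiv.swap a.1.1 a.1.2 * u) := by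
        rw [← mul_assoc, Equiv.swap_mul_self, one_mul]
      rw [e]
      refine step a _ hza (ih _ ?_ _ ?_ rfl)
      · rw [← hn]
        have hsum : ∑ j : Fin N, (j : ℕ) * ((Equiv.swap a.1.1 a.1.2 * u)⁻¹ j : ℕ) >
            ∑ j : Fin N, (j : ℕ) * (u⁻¹ j : ℕ) := by
          rw [← Equiv.sum_comp (Equiv.swap a.1.1 a.1.2)]
          simp only [mul_inv_rev, Equiv.swap_inv, Equiv.Perm.mul_apply, Equiv.swap_apply_self]
          rw [← Finset.add_sum_erase _ _ (mem_univ a.1.1),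
            ← Finset.add_sum_erase (univ.erase a.1.1) _ (mem_erase.2 ⟨a.ne.symm, mem_univ a.1.2⟩),
            ← Finset.add_sum_erase univ (fun j : Fin N => (j : ℕ) * (u⁻¹ j : ℕ)) (mem_univ a.1.1),
            ← Finset.add_sum_erase (univ.erase a.1.1) (fun j : Fin N => (j : ℕ) * (u⁻¹ j : ℕ)) (mem_erase.2 ⟨a.ne.symm, mem_univ a.1.2⟩)]
          have : ∑ j ∈ (univ.erase a.1.1).erase a.1.2, (Equiv.swap a.1.1 a.1.2 j : ℕ) * (u⁻¹ j : ℕ) =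
              ∑ j ∈ (univ.erase a.1.1).erase a.1.2, (j : ℕ) * (u⁻¹ j : ℕ) := by
            refine Finset.sum_congr rfl fun j hj => ?_
            simp only [mem_erase, mem_univ, and_true] at hj
            rw [Equiv.swap_apply_of_ne_of_ne hj.2 hj.1]
          rw [this, Equiv.swap_apply_left, Equiv.swap_apply_right, ← a.2]
          rw [Fin.lt_def] at hlt
          nlinarith
        have hbd : ∀ v : Equiv.Perm (Fin N), ∑ j : Fin N, (j : ℕ) * (v j : ℕ) ≤ N * N * N := by
          intro v
          calc ∑ j : Fin N, (j : ℕ) * (v j : ℕ) ≤ ∑ j : Fin N, N * N :=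
                Finset.sum_le_sum fun j _ => Nat.mul_le_mul j.2.le (v j).2.le
            _ = N * N * N := by simp; ring
        have := hbd (Equiv.swap a.1.1 a.1.2 * u)⁻¹
        omega
      · rw [act_mul, hu, act_swap_of_eq hza]
  exact key _ u hu rfl

theorem wordPerm_cons {N : ℕ} (a : Adj N) (l : List (Adj N)) :
    wordPerm (a :: l) = Equiv.swap a.1.1 a.1.2 * wordPerm l := by
  simp [wordPerm]

/-- On the wall the reflection fixes the point and the integral has length zero. -/
theorem simpleRefl_apply_of_eq {N : ℕ} (γ : ℝ) (a : Adj N) (f : (Fin N → ℝ) → ℂ) {z : Fin N → ℝ}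
    (h : z a.1.1 = z a.1.2) : simpleRefl γ a f z = f z := by
  rw [simpleRefl, Equiv.swap_inv, act_swap_of_eq h, intOp, h, sub_self,
    intervalIntegral.integral_same, mul_zero, add_zero]

theorem wordRefl_apply_of_stabilizer {N : ℕ} (γ : ℝ) (lam : Fin N → ℂ) {z : Fin N → ℝ}
    (hz : Antitone z) (u : Equiv.Perm (Fin N)) (hu : act u z = z) :
    ∀ l l' : List (Adj N), wordPerm l' = u * wordPerm l →
      wordRefl γ l' (planeWave lam) z = wordRefl γ l (planeWave lam) z := by
  refine stabilizer_induction hz (P := fun u => ∀ l l' : List (Adj N),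
    wordPerm l' = u * wordPerm l →
      wordRefl γ l' (planeWave lam) z = wordRefl γ l (planeWave lam) z) ?_ ?_ u hu
  · intro l l' h
    exact wordRefl_planeWave_congr γ (by simpa using h) lam z
  · intro a u ha ih l l' h
    obtain ⟨m, hm⟩ := exists_word (u * wordPerm l)
    rw [← ih l m hm, wordRefl_planeWave_congr γ (l' := a :: m)]
    · exact simpleRefl_apply_of_eq γ a _ ha
    · rw [h, wordPerm_cons, hm, mul_assoc]

theorem antitone_act_eq {N : ℕ} {x : Fin N → ℝ} {v w : Equiv.Perm (Fin N)}
    (hv : Antitone (act v x)) (hw : Antitone (act w x)) : act v x = act w x := by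
  have h := Tuple.unique_monotone (f := fun j => OrderDual.toDual (x j)) (σ := v⁻¹) (τ := w⁻¹)
    (fun i j hij => hv hij) (fun i j hij => hw hij)
  exact h

/-- On each closed alcove the wavefunction is given by any word that represents the corresponding
permutation. -/
theorem psi_eq {N : ℕ} (γ : ℝ) (lam : Fin N → ℂ) {x : Fin N → ℝ} (l : List (Adj N))
    (h : Antitone (act (wordPerm l) x)) :
    psi γ lam x = wordRefl γ l (planeWave lam) (act (wordPerm l) x) := by
  have e := antitone_act_eq (antitone_act_sorter x) h
  rw [psi, propagation, permRefl, e]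
  have hs : wordPerm (exists_word (sorter x)).choose = sorter x := (exists_word (sorter x)).choose_spec
  -- Two sorting permutations of `x` yield the same sorted point, hence differ by an element of its
  -- stabilizer.
  refine wordRefl_apply_of_stabilizer γ lam h (sorter x * (wordPerm l)⁻¹) ?_ _ _ ?_
  · rw [act_mul, act_inv_act, e]
  · rw [hs, inv_mul_cancel_right]

theorem psi_of_antitone {N : ℕ} (γ : ℝ) (lam : Fin N → ℂ) {x : Fin N → ℝ} (h : Antitone x) :
    psi γ lam x = planeWave lam x := by
  have e : act (wordPerm ([] : List (Adj N))) x = x := act_one x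
  rw [psi_eq γ lam [] (by rwa [e]), e]
  rfl

/-! ### Continuity of the wavefunction and the exchange relation -/

theorem exists_word_sorts {N : ℕ} (x : Fin N → ℝ) :
    ∃ l : List (Adj N), Antitone (act (wordPerm l) x) := by
  obtain ⟨l, hl⟩ := exists_word (sorter x)
  exact ⟨l, hl ▸ antitone_act_sorter x⟩

/-- The closed alcoves form a finite closed cover, and on each of them a fixed word computes `psi`,
walls included. -/
theorem continuous_psi {N : ℕ} (γ : ℝ) :
    Continuous fun p : (Fin N → ℂ) × (Fin N → ℝ) => psi γ p.1 p.2 := by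
  choose W hW using fun w : Equiv.Perm (Fin N) => exists_word w
  refine LocallyFinite.continuous (f := fun w : Equiv.Perm (Fin N) =>
    {p : (Fin N → ℂ) × (Fin N → ℝ) | Antitone (act w p.2)}) (locallyFinite_of_finite _) ?_ ?_ ?_
  · exact Set.eq_univ_of_forall fun p => Set.mem_iUnion.2 ⟨sorter p.2, antitone_act_sorter p.2⟩
  · intro w
    have hc : Continuous fun p : (Fin N → ℂ) × (Fin N → ℝ) => act w p.2 := by unfold act; fun_prop
    exact isClosed_antitone.preimage hc
  · intro w
    have hc : Continuous fun p : (Fin N → ℂ) × (Fin N → ℝ) =>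
        wordRefl γ (W w) (planeWave p.1) (act w p.2) := by
      refine (continuous_wordRefl γ (W w) continuous_planeWave).comp
        (f := fun p : (Fin N → ℂ) × (Fin N → ℝ) => (p.1, act w p.2)) ?_
      unfold act
      fun_prop
    refine hc.continuousOn.congr fun p hp => ?_
    have := psi_eq γ p.1 (x := p.2) (W w) (by rw [hW]; exact hp)
    rwa [hW] at this

/-- If `l` sorts `x`, then `l ++ [a]` sorts the swapped point to the same place, and the extra
letter acts directly on the plane wave. -/
theorem psi_act_swap {N : ℕ} (γ : ℝ) {lam : Fin N → ℂ} (a : Adj N)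
    (h : lam a.1.1 ≠ lam a.1.2) (x : Fin N → ℝ) :
    psi γ lam (act (Equiv.swap a.1.1 a.1.2) x) =
      (1 + Complex.I * γ / (lam a.1.1 - lam a.1.2)) *
        psi γ (lam ∘ Equiv.swap a.1.1 a.1.2) x -
      Complex.I * γ / (lam a.1.1 - lam a.1.2) * psi γ lam x := by
  obtain ⟨l, hl⟩ := exists_word_sorts x
  have e : act (wordPerm (l ++ [a])) (act (Equiv.swap a.1.1 a.1.2) x) = act (wordPerm l) x := by
    rw [wordPerm_append, act_mul, ← act_mul (wordPerm [a])]
    simp [wordPerm, act_one]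
  rw [psi_eq γ _ l hl, psi_eq γ _ l hl, psi_eq γ lam (l ++ [a]) (by rwa [e]), e,
    wordRefl_concat_planeWave γ l a h]

/-! ### Adding a particle at either end, and reflection -/

/-- Lifting words along an embedding of labels. -/
theorem psi_eq_of_lift {N N' : ℕ} (γ : ℝ) (σ : Adj N → Adj N') (ρ : (Fin N → ℝ) → Fin N' → ℝ)
    (hact : ∀ a x, act (Equiv.swap (σ a).1.1 (σ a).1.2) (ρ x) =
      ρ (act (Equiv.swap a.1.1 a.1.2) x))
    (hint : ∀ a (x : Fin N → ℝ) (y : ℝ),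
      ρ x - y • ((Pi.single (σ a).1.1 1 : Fin N' → ℝ) - (Pi.single (σ a).1.2 1 : Fin N' → ℝ)) =
        ρ (x - y • ((Pi.single a.1.1 1 : Fin N → ℝ) - (Pi.single a.1.2 1 : Fin N → ℝ))))
    (hsub : ∀ a x, ρ x (σ a).1.1 - ρ x (σ a).1.2 = x a.1.1 - x a.1.2)
    {lam : Fin N → ℂ} {lam' : Fin N' → ℂ} (C : ℂ)
    (hwave : ∀ x, planeWave lam' (ρ x) = C * planeWave lam x) {x : Fin N → ℝ}
    (hanti : ∀ w, Antitone (act w x) → Antitone (ρ (act w x))) :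
    psi γ lam' (ρ x) = C * psi γ lam x := by
  have hA : ∀ (l : List (Adj N)) x, act (wordPerm (l.map σ)) (ρ x) = ρ (act (wordPerm l) x) := by
    intro l
    induction l with
    | nil => intro x; simp [wordPerm, act_one]
    | cons a l ih =>
      intro x
      rw [List.map_cons, wordPerm_cons, wordPerm_cons, act_mul, act_mul, ih, hact]
  have hW : ∀ (l : List (Adj N)) x, wordRefl γ (l.map σ) (planeWave lam') (ρ x) =
      C * wordRefl γ l (planeWave lam) x := by
    intro l
    induction l with
    | nil => exact hwave
    | cons a l ih =>
      intro x
      change simpleRefl γ (σ a) (wordRefl γ (l.map σ) (planeWave lam')) (ρ x) =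
        C * simpleRefl γ a (wordRefl γ l (planeWave lam)) x
      simp only [simpleRefl, Equiv.swap_inv, hact, ih, intOp, hint, hsub,
        intervalIntegral.integral_const_mul]
      ring
  obtain ⟨l, hl⟩ := exists_word_sorts x
  rw [psi_eq γ lam l hl, psi_eq γ lam' (l.map σ) (by rw [hA]; exact hanti _ hl), hA, hW]

/-- The pair of neighbouring labels shifted by one. -/
def Adj.succ {N : ℕ} (a : Adj N) : Adj (N + 1) :=
  ⟨(a.1.1.succ, a.1.2.succ), by simp [a.2]⟩

/-- The pair of neighbouring labels, regarded as labels of a longer sequence. -/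
def Adj.castSucc {N : ℕ} (a : Adj N) : Adj (N + 1) :=
  ⟨(a.1.1.castSucc, a.1.2.castSucc), by simp [a.2]⟩

/-- The reflected pair of neighbouring labels. -/
def Adj.rev {N : ℕ} (a : Adj N) : Adj N :=
  ⟨(a.1.2.rev, a.1.1.rev), by
    have := a.2
    have := a.1.2.2
    simp only [Fin.val_rev]
    omega⟩

theorem swap_succ_apply {N : ℕ} (a b j : Fin N) :
    Equiv.swap a.succ b.succ j.succ = (Equiv.swap a b j).succ := by
  simp only [Equiv.swap_apply_def, Fin.succ_inj]
  split_ifs <;> rfl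

theorem swap_castSucc_apply {N : ℕ} (a b j : Fin N) :
    Equiv.swap a.castSucc b.castSucc j.castSucc = (Equiv.swap a b j).castSucc := by
  simp only [Equiv.swap_apply_def, Fin.castSucc_inj]
  split_ifs <;> rfl

theorem act_succ_cons {N : ℕ} (a : Adj N) (x0 : ℝ) (x : Fin N → ℝ) :
    act (Equiv.swap a.succ.1.1 a.succ.1.2) (Fin.cons x0 x) =
      Fin.cons x0 (act (Equiv.swap a.1.1 a.1.2) x) := by
  ext j
  cases j using Fin.cases with
  | zero =>
    simp [act, Adj.succ, Equiv.swap_apply_of_ne_of_ne (Fin.succ_ne_zero _).symm (Fin.succ_ne_zero _).symm]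
  | succ j => simp [act, Adj.succ, swap_succ_apply]

theorem act_castSucc_snoc {N : ℕ} (a : Adj N) (x0 : ℝ) (x : Fin N → ℝ) :
    act (Equiv.swap a.castSucc.1.1 a.castSucc.1.2) (Fin.snoc x x0) =
      Fin.snoc (act (Equiv.swap a.1.1 a.1.2) x) x0 := by
  ext j
  cases j using Fin.lastCases with
  | last =>
    simp [act, Adj.castSucc, Equiv.swap_apply_of_ne_of_ne (Fin.castSucc_ne_last _).symm (Fin.castSucc_ne_last _).symm]
  | cast j => simp [act, Adj.castSucc, swap_castSucc_apply]

theorem planeWave_cons {N : ℕ} (μ : ℂ) (lam : Fin N → ℂ) (x0 : ℝ) (x : Fin N → ℝ) :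
    planeWave (Fin.cons μ lam) (Fin.cons x0 x : Fin (N + 1) → ℝ) =
      Complex.exp (Complex.I * μ * x0) * planeWave lam x := by
  unfold planeWave
  rw [← Complex.exp_add, Fin.sum_univ_succ]
  simp only [Fin.cons_zero, Fin.cons_succ]
  ring_nf

theorem planeWave_snoc {N : ℕ} (μ : ℂ) (lam : Fin N → ℂ) (x0 : ℝ) (x : Fin N → ℝ) :
    planeWave (Fin.snoc lam μ) (Fin.snoc x x0 : Fin (N + 1) → ℝ) =
      Complex.exp (Complex.I * μ * x0) * planeWave lam x := by
  unfold planeWave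
  rw [← Complex.exp_add, Fin.sum_univ_castSucc]
  simp only [Fin.snoc_castSucc, Fin.snoc_last]
  ring_nf

/-- A largest coordinate in first place is already sorted, so the shifted words suffice and never
touch it. -/
theorem psi_cons_of_le {N : ℕ} (γ : ℝ) (μ : ℂ) (lam : Fin N → ℂ) {x0 : ℝ} {x : Fin N → ℝ}
    (h : ∀ j, x j ≤ x0) :
    psi γ (Fin.cons μ lam) (Fin.cons x0 x : Fin (N + 1) → ℝ) =
      Complex.exp (Complex.I * μ * x0) * psi γ lam x := by
  refine psi_eq_of_lift γ Adj.succ (fun x => Fin.cons x0 x) (fun a x => act_succ_cons a x0 x) ?_ ?_ _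
    (planeWave_cons μ lam x0) ?_
  · intro a x y
    ext j
    cases j using Fin.cases with
    | zero => simp [Adj.succ, (Fin.succ_ne_zero _).symm]
    | succ j => simp [Adj.succ, Pi.single_apply]
  · intro a x
    simp [Adj.succ]
  · intro w hw i j hij
    cases i using Fin.cases with
    | zero =>
      cases j using Fin.cases with
      | zero => simp
      | succ j => simpa [act] using h _
    | succ i =>
      cases j using Fin.cases with
      | zero => simp at hij
      | succ j => simpa using hw (Fin.succ_le_succ_iff.1 hij)

theorem psi_snoc_of_le {N : ℕ} (γ : ℝ) (μ : ℂ) (lam : Fin N → ℂ) {x0 : ℝ} {x : Fin N → ℝ}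
    (h : ∀ j, x0 ≤ x j) :
    psi γ (Fin.snoc lam μ) (Fin.snoc x x0 : Fin (N + 1) → ℝ) =
      Complex.exp (Complex.I * μ * x0) * psi γ lam x := by
  refine psi_eq_of_lift γ Adj.castSucc (fun x => Fin.snoc x x0) (fun a x => act_castSucc_snoc a x0 x)
    ?_ ?_ _ (planeWave_snoc μ lam x0) ?_
  · intro a x y
    ext j
    cases j using Fin.lastCases with
    | last => simp [Adj.castSucc, (Fin.castSucc_ne_last _).symm]
    | cast j => simp [Adj.castSucc, Pi.single_apply]
  · intro a x
    simp [Adj.castSucc]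
  · intro w hw i j hij
    cases j using Fin.lastCases with
    | last =>
      cases i using Fin.lastCases with
      | last => simp
      | cast i => simpa [act] using h _
    | cast j =>
      cases i using Fin.lastCases with
      | last => exact absurd hij (by simp)
      | cast i => simpa using hw (Fin.castSucc_le_castSucc_iff.1 hij)

/-- The reflection `x ↦ (-x_N, …, -x_1)`. -/
def refl {R : Type*} [Neg R] {N : ℕ} (x : Fin N → R) : Fin N → R := fun j => -x j.rev

/-- Reversal of labels and negation together preserve decreasing order and the differences of
neighbours, so `γ` keeps its sign. -/
theorem psi_refl {N : ℕ} (γ : ℝ) (lam : Fin N → ℂ) (x : Fin N → ℝ) :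
    psi γ (refl lam) (refl x) = psi γ lam x := by
  have hrev : ∀ a b : Fin N, a.rev = b ↔ a = b.rev := fun a b => Fin.rev_eq_iff
  rw [← one_mul (psi γ lam x)]
  refine psi_eq_of_lift γ Adj.rev refl ?_ ?_ ?_ 1 ?_ ?_
  · intro a x
    ext j
    simp only [act, refl, Adj.rev, Equiv.swap_inv]
    congr 2
    simp only [Equiv.swap_apply_def, hrev]
    split_ifs <;> simp_all
  · intro a x y
    ext j
    simp only [refl, Adj.rev, Pi.sub_apply, Pi.smul_apply, smul_eq_mul, Pi.single_apply, hrev]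
    ring
  · intro a x
    simp [refl, Adj.rev]
    ring
  · intro x
    unfold planeWave
    rw [one_mul]
    congr 2
    rw [← Equiv.sum_comp Fin.revPerm]
    simp [refl]
  · intro w hw i j hij
    exact neg_le_neg (hw (Fin.rev_le_rev.2 hij))

/-! ### The Dunkl-type differential equations -/

/-- The sign with which the reflection in the labels `j`, `k` enters the Dunkl-type operator. -/
noncomputable def dunklSign {N : ℕ} (y : Fin N → ℝ) (j k : Fin N) : ℂ :=
  (if k < j ∧ y k < y j then 1 else 0) - (if j < k ∧ y j < y k then 1 else 0)

theorem Adj.swap_lt_swap {N : ℕ} (a : Adj N) {j k : Fin N} (h1 : ¬(j = a.1.1 ∧ k = a.1.2))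
    (h2 : ¬(j = a.1.2 ∧ k = a.1.1)) :
    Equiv.swap a.1.1 a.1.2 j < Equiv.swap a.1.1 a.1.2 k ↔ j < k := by
  have := a.2
  simp only [Equiv.swap_apply_def]
  simp only [Fin.ext_iff, Fin.lt_def] at *
  split_ifs <;> omega

/-- A simple transposition preserves the order of every pair of labels except its own. -/
theorem dunklSign_swap {N : ℕ} (a : Adj N) (y : Fin N → ℝ) {j k : Fin N}
    (h1 : ¬(j = a.1.1 ∧ k = a.1.2)) (h2 : ¬(j = a.1.2 ∧ k = a.1.1)) :
    dunklSign y (Equiv.swap a.1.1 a.1.2 j) (Equiv.swap a.1.1 a.1.2 k) =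
      dunklSign (act (Equiv.swap a.1.1 a.1.2) y) j k := by
  simp only [dunklSign, act, Equiv.swap_inv]
  exact congrArg₂ (· - ·)
    (if_congr (and_congr_left' (a.swap_lt_swap (fun h => h2 h.symm) fun h => h1 h.symm)) rfl rfl)
    (if_congr (and_congr_left' (a.swap_lt_swap h1 h2)) rfl rfl)

theorem act_swap_update {N : ℕ} (σ : Equiv.Perm (Fin N)) (y : Fin N → ℝ) (j : Fin N) (s : ℝ) :
    Function.update (act σ y) j s = act σ (Function.update y (σ⁻¹ j) s) := by
  ext k
  by_cases h : k = j
  · subst h; simp [act]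
  · rw [Function.update_of_ne h, act, act, Function.update_of_ne (σ⁻¹.injective.ne h)]

/-- Only the pair `a` itself violates covariance of the signs, by $\pm1$. The resulting term cancels
the mismatch between $\lambda_j$ and $\lambda_{s(j)}$ when the exchange relation is differentiated.
-/
theorem hasDerivAt_psi_act_swap_aux {N : ℕ} (γ : ℝ) (a : Adj N) {lam : Fin N → ℂ}
    (hlam : Function.Injective lam) (j : Fin N) (y : Fin N → ℝ)
    (hy : ∀ k, k ≠ Equiv.swap a.1.1 a.1.2 j → y k ≠ y (Equiv.swap a.1.1 a.1.2 j))
    (ψ : (Fin N → ℝ) → ℂ) :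
    γ * ∑ k, dunklSign y (Equiv.swap a.1.1 a.1.2 j) (Equiv.swap a.1.1 a.1.2 k) *
        ψ (act (Equiv.swap j k) (act (Equiv.swap a.1.1 a.1.2) y)) =
      γ * ∑ k, dunklSign (act (Equiv.swap a.1.1 a.1.2) y) j k *
        ψ (act (Equiv.swap j k) (act (Equiv.swap a.1.1 a.1.2) y)) -
      Complex.I * γ / (lam a.1.1 - lam a.1.2) * Complex.I *
        (lam j - lam (Equiv.swap a.1.1 a.1.2 j)) * ψ y := by
  have hne := a.ne
  have hd : lam a.1.1 - lam a.1.2 ≠ 0 := sub_ne_zero.2 (hlam.ne hne)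
  have hswap : act (Equiv.swap a.1.1 a.1.2) (act (Equiv.swap a.1.1 a.1.2) y) = y := by
    rw [← act_mul, Equiv.swap_mul_self, act_one]
  have hlt : a.1.1 < a.1.2 := Fin.lt_def.2 (by have := a.2; omega)
  have hnlt := hlt.not_gt
  suffices h : γ * (∑ k, dunklSign y (Equiv.swap a.1.1 a.1.2 j) (Equiv.swap a.1.1 a.1.2 k) *
        ψ (act (Equiv.swap j k) (act (Equiv.swap a.1.1 a.1.2) y)) -
      ∑ k, dunklSign (act (Equiv.swap a.1.1 a.1.2) y) j k *
        ψ (act (Equiv.swap j k) (act (Equiv.swap a.1.1 a.1.2) y))) =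
      -(Complex.I * γ / (lam a.1.1 - lam a.1.2) * Complex.I *
        (lam j - lam (Equiv.swap a.1.1 a.1.2 j)) * ψ y) by
    rw [mul_sub] at h
    linear_combination h
  rw [← Finset.sum_sub_distrib]
  simp only [← sub_mul]
  by_cases hja : j = a.1.1
  · subst hja
    have hy := hy a.1.1 (by rw [Equiv.swap_apply_left]; exact hne)
    rw [Equiv.swap_apply_left] at hy
    rw [Finset.sum_eq_single a.1.2]
    · rw [hswap, Equiv.swap_apply_left, Equiv.swap_apply_right]
      have : dunklSign y a.1.2 a.1.1 - dunklSign (act (Equiv.swap a.1.1 a.1.2) y) a.1.1 a.1.2 = 1 := by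
        simp only [dunklSign, act, Equiv.swap_inv, Equiv.swap_apply_left, Equiv.swap_apply_right,
          hlt, hnlt, true_and, false_and, if_false]
        rcases lt_or_gt_of_ne hy with h | h <;> simp [h, h.not_gt]
      rw [this]
      field_simp
      linear_combination ((γ : ℂ) * ψ y) * Complex.I_sq
    · intro k _ hk
      rw [dunklSign_swap a y (fun h => hk h.2) (fun h => hne h.1), sub_self, zero_mul]
    · simp
  · by_cases hjb : j = a.1.2
    · subst hjb
      have hy := (hy a.1.2 (by rw [Equiv.swap_apply_right]; exact hne.symm)).symm
      rw [Equiv.swap_apply_right] at hy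
      rw [Finset.sum_eq_single a.1.1]
      · rw [Equiv.swap_comm a.1.2 a.1.1, hswap, Equiv.swap_apply_left, Equiv.swap_apply_right]
        have : dunklSign y a.1.1 a.1.2 - dunklSign (act (Equiv.swap a.1.1 a.1.2) y) a.1.2 a.1.1 = -1 := by
          simp only [dunklSign, act, Equiv.swap_inv, Equiv.swap_apply_left, Equiv.swap_apply_right,
            hlt, hnlt, true_and, false_and, if_false]
          rcases lt_or_gt_of_ne hy with h | h <;> simp [h, h.not_gt]
        rw [this, ← neg_sub (lam a.1.1) (lam a.1.2)]
        field_simp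
        linear_combination (-(γ : ℂ) * ψ y) * Complex.I_sq
      · intro k _ hk
        rw [dunklSign_swap a y (fun h => hja h.1) (fun h => hk h.2), sub_self, zero_mul]
      · simp
    · rw [Equiv.swap_apply_of_ne_of_ne hja hjb, sub_self, mul_zero, zero_mul, neg_zero]
      refine mul_eq_zero_of_right _ (Finset.sum_eq_zero fun k _ => ?_)
      have := dunklSign_swap a y (j := j) (k := k) (fun h => hja h.1) (fun h => hjb h.1)
      rw [Equiv.swap_apply_of_ne_of_ne hja hjb] at this
      rw [this, sub_self, zero_mul]

/-- In the closed fundamental alcove all signs vanish and $\psi$ is a plane wave. The point stays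
there under small changes of $y_j$, since no other coordinate equals $y_j$. -/
theorem hasDerivAt_psi_of_antitone {N : ℕ} (γ : ℝ) (lam : Fin N → ℂ) (j : Fin N) {y : Fin N → ℝ}
    (hy : ∀ k, k ≠ j → y k ≠ y j) (hanti : Antitone y) :
    HasDerivAt (fun s => psi γ lam (Function.update y j s))
      (Complex.I * lam j * psi γ lam y +
        γ * ∑ k, dunklSign y j k * psi γ lam (act (Equiv.swap j k) y)) (y j) := by
  have h0 : ∑ k, dunklSign y j k * psi γ lam (act (Equiv.swap j k) y) = 0 := by
    refine Finset.sum_eq_zero fun k _ => ?_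
    have h1 : ¬(k < j ∧ y k < y j) := fun h => (hanti h.1.le).not_gt h.2
    have h2 : ¬(j < k ∧ y j < y k) := fun h => (hanti h.1.le).not_gt h.2
    rw [dunklSign, if_neg h1, if_neg h2, sub_self, zero_mul]
  have hev : ∀ᶠ s in nhds (y j), psi γ lam (Function.update y j s) =
      planeWave lam (Function.update y j s) := by
    have hk : ∀ k, ∀ᶠ s in nhds (y j), (k < j → s < y k) ∧ (j < k → y k < s) := by
      intro k
      rcases lt_trichotomy k j with h | h | h
      · filter_upwards [Iio_mem_nhds (lt_of_le_of_ne (hanti h.le) (hy k h.ne).symm)] with s hs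
        exact ⟨fun _ => hs, fun h' => absurd h' h.not_gt⟩
      · subst h
        simp
      · filter_upwards [Ioi_mem_nhds (lt_of_le_of_ne (hanti h.le) (hy k h.ne'))] with s hs
        exact ⟨fun h' => absurd h' h.not_gt, fun _ => hs⟩
    filter_upwards [Filter.eventually_all.2 hk] with s hs
    refine psi_of_antitone γ lam fun p q hpq => ?_
    by_cases hp : p = j
    · subst hp
      by_cases hq : q = p
      · subst hq; rfl
      · rw [Function.update_self, Function.update_of_ne hq]
        exact ((hs q).2 (lt_of_le_of_ne hpq (Ne.symm hq))).le
    · rw [Function.update_of_ne hp]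
      by_cases hq : q = j
      · subst hq
        rw [Function.update_self]
        exact ((hs p).1 (lt_of_le_of_ne hpq hp)).le
      · rw [Function.update_of_ne hq]
        exact hanti hpq
  rw [h0, mul_zero, add_zero, psi_of_antitone γ lam hanti]
  refine HasDerivAt.congr_of_eventuallyEq ?_ hev
  have hw : ∀ s : ℝ, planeWave lam (Function.update y j s) =
      planeWave lam y * Complex.exp (Complex.I * lam j * ((s - y j : ℝ) : ℂ)) := by
    intro s
    unfold planeWave
    rw [← Complex.exp_add]
    congr 1
    rw [← Finset.add_sum_erase _ _ (mem_univ j), ← Finset.add_sum_erase _ _ (mem_univ j),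
      Function.update_self]
    rw [Finset.sum_congr rfl (g := fun k => lam k * (y k : ℂ)) fun k hk => by
      rw [Function.update_of_ne (Finset.ne_of_mem_erase hk)]]
    push_cast
    ring
  simp only [hw]
  have h1 : HasDerivAt (fun s : ℝ => ((s - y j : ℝ) : ℂ)) 1 (y j) := by
    simpa using ((hasDerivAt_id (y j)).sub_const (y j)).ofReal_comp
  have h2 := ((h1.const_mul (Complex.I * lam j)).cexp).const_mul (planeWave lam y)
  refine h2.congr_deriv ?_
  rw [sub_self, Complex.ofReal_zero, mul_zero, Complex.exp_zero]
  ring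

/-- The wavefunctions are eigenfunctions of the Dunkl-type operators. -/
theorem hasDerivAt_psi {N : ℕ} (γ : ℝ) {lam : Fin N → ℂ} (hlam : Function.Injective lam)
    (j : Fin N) {y : Fin N → ℝ} (hy : ∀ k, k ≠ j → y k ≠ y j) :
    HasDerivAt (fun s => psi γ lam (Function.update y j s))
      (Complex.I * lam j * psi γ lam y +
        γ * ∑ k, dunklSign y j k * psi γ lam (act (Equiv.swap j k) y)) (y j) := by
  obtain ⟨l, hl⟩ := exists_word_sorts y
  obtain ⟨m, hm⟩ := exists_word (wordPerm l)⁻¹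
  -- Induction on a word leading from the fundamental alcove to the point; `lam` and `j` vary
  -- because the exchange relation permutes both.
  have key : ∀ (m : List (Adj N)) (lam : Fin N → ℂ), Function.Injective lam → ∀ (j : Fin N)
      (z : Fin N → ℝ), (∀ k, k ≠ j → act (wordPerm m) z k ≠ act (wordPerm m) z j) → Antitone z →
      HasDerivAt (fun s => psi γ lam (Function.update (act (wordPerm m) z) j s))
      (Complex.I * lam j * psi γ lam (act (wordPerm m) z) +
        γ * ∑ k, dunklSign (act (wordPerm m) z) j k *
          psi γ lam (act (Equiv.swap j k) (act (wordPerm m) z))) (act (wordPerm m) z j) := by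
    intro m
    induction m with
    | nil =>
      intro lam _ j z hz hanti
      rw [show act (wordPerm ([] : List (Adj N))) z = z from act_one z] at hz ⊢
      exact hasDerivAt_psi_of_antitone γ lam j hz hanti
    | cons a m ih =>
      intro lam hlam j z hz hanti
      rw [wordPerm_cons, act_mul] at hz ⊢
      have hy' : ∀ k, k ≠ Equiv.swap a.1.1 a.1.2 j →
          act (wordPerm m) z k ≠ act (wordPerm m) z (Equiv.swap a.1.1 a.1.2 j) := by
        intro k hk
        have := hz (Equiv.swap a.1.1 a.1.2 k) fun h => hk (by rw [← h, Equiv.swap_apply_self])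
        rwa [act, Equiv.swap_inv, Equiv.swap_apply_self, act] at this
      have i1 := ih (lam ∘ Equiv.swap a.1.1 a.1.2) (hlam.comp (Equiv.swap _ _).injective)
        (Equiv.swap a.1.1 a.1.2 j) z hy' hanti
      have i2 := ih lam hlam (Equiv.swap a.1.1 a.1.2 j) z hy' hanti
      generalize act (wordPerm m) z = y at *
      have hs := fun x => psi_act_swap γ a (hlam.ne a.ne) x
      simp only [act_swap_update, hs, Equiv.swap_inv]
      have e0 : act (Equiv.swap a.1.1 a.1.2) y j = y (Equiv.swap a.1.1 a.1.2 j) := by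
        rw [act, Equiv.swap_inv]
      rw [e0]
      have := (i1.const_mul (1 + Complex.I * γ / (lam a.1.1 - lam a.1.2))).sub
        (i2.const_mul (Complex.I * γ / (lam a.1.1 - lam a.1.2)))
      refine this.congr_deriv ?_
      rw [Function.comp_apply, Equiv.swap_apply_self]
      have haux := hasDerivAt_psi_act_swap_aux γ a hlam j y hy' (psi γ lam)
      have hsum : ∑ k, dunklSign y (Equiv.swap a.1.1 a.1.2 j) (Equiv.swap a.1.1 a.1.2 k) *
          psi γ lam (act (Equiv.swap j k) (act (Equiv.swap a.1.1 a.1.2) y)) =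
          (1 + Complex.I * γ / (lam a.1.1 - lam a.1.2)) *
            ∑ k, dunklSign y (Equiv.swap a.1.1 a.1.2 j) k *
              psi γ (lam ∘ Equiv.swap a.1.1 a.1.2)
                (act (Equiv.swap (Equiv.swap a.1.1 a.1.2 j) k) y) -
          Complex.I * γ / (lam a.1.1 - lam a.1.2) *
            ∑ k, dunklSign y (Equiv.swap a.1.1 a.1.2 j) k *
              psi γ lam (act (Equiv.swap (Equiv.swap a.1.1 a.1.2 j) k) y) := by
        rw [Finset.mul_sum, Finset.mul_sum, ← Finset.sum_sub_distrib,
          ← Equiv.sum_comp (Equiv.swap a.1.1 a.1.2)]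
        refine Finset.sum_congr rfl fun k _ => ?_
        have e : act (Equiv.swap j (Equiv.swap a.1.1 a.1.2 k)) (act (Equiv.swap a.1.1 a.1.2) y) =
            act (Equiv.swap a.1.1 a.1.2) (act (Equiv.swap (Equiv.swap a.1.1 a.1.2 j) k) y) := by
          rw [← act_mul, ← act_mul, Equiv.mul_swap_eq_swap_mul _ (Equiv.swap a.1.1 a.1.2 j),
            Equiv.swap_apply_self]
        rw [e, hs, Equiv.swap_apply_self]
        ring
      rw [hsum] at haux
      linear_combination haux
  have := key m lam hlam j (act (wordPerm l) y)
  rw [hm, act_inv_act] at this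
  exact this hy hl

/-! ### The integral equation for the dependence on the first coordinate -/

theorem act_swap_zero_succ {N : ℕ} (k : Fin N) (s : ℝ) (x : Fin N → ℝ) :
    act (Equiv.swap 0 k.succ) (Fin.cons s x : Fin (N + 1) → ℝ) =
      Fin.cons (x k) (Function.update x k s) := by
  ext j
  rw [act, Equiv.swap_inv]
  cases j using Fin.cases with
  | zero => simp
  | succ j =>
    by_cases h : j = k
    · subst h; simp
    · rw [Equiv.swap_apply_of_ne_of_ne (Fin.succ_ne_zero j) (by simpa using h)]
      simp [h]

theorem continuous_psi_cons_update {N : ℕ} (γ : ℝ) (x : Fin N → ℝ) (k : Fin N) :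
    Continuous fun p : (Fin (N + 1) → ℂ) × ℝ =>
      psi γ p.1 (Fin.cons (x k) (Function.update x k p.2)) := by
  refine (continuous_psi γ).comp (f := fun p : (Fin (N + 1) → ℂ) × ℝ =>
    (p.1, (Fin.cons (x k) (Function.update x k p.2) : Fin (N + 1) → ℝ))) (continuous_fst.prodMk ?_)
  exact Continuous.finCons continuous_const (continuous_const.update k continuous_snd)

theorem continuous_psi_cons {N : ℕ} (γ : ℝ) (lam : Fin (N + 1) → ℂ) (x : Fin N → ℝ) :
    Continuous fun s : ℝ => psi γ lam (Fin.cons s x : Fin (N + 1) → ℝ) :=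
  (continuous_psi γ).comp (f := fun s : ℝ => (lam, (Fin.cons s x : Fin (N + 1) → ℝ)))
    (continuous_const.prodMk (Continuous.finCons continuous_id continuous_const))

/-- For the first coordinate only labels to its right contribute. Off the range of `x` the condition
`s ≤ x k` equals the strict one, and it is convenient as the indicator of a closed half-line. -/
theorem hasDerivAt_psi_cons {N : ℕ} (γ : ℝ) {lam : Fin (N + 1) → ℂ}
    (hlam : Function.Injective lam) (x : Fin N → ℝ) {s : ℝ} (hs : s ∉ Set.range x) :
    HasDerivAt (fun s => psi γ lam (Fin.cons s x : Fin (N + 1) → ℝ))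
      (Complex.I * lam 0 * psi γ lam (Fin.cons s x : Fin (N + 1) → ℝ) -
        γ * ∑ k, if s ≤ x k then psi γ lam (Fin.cons (x k) (Function.update x k s)) else 0) s := by
  have h := hasDerivAt_psi γ hlam 0 (y := (Fin.cons s x : Fin (N + 1) → ℝ)) (by
    intro k hk
    obtain ⟨k, rfl⟩ := Fin.exists_succ_eq.2 hk
    rw [Fin.cons_succ, Fin.cons_zero]
    exact fun h => hs ⟨k, h⟩)
  simp only [Fin.update_cons_zero, Fin.cons_zero] at h
  refine h.congr_deriv ?_
  rw [Fin.sum_univ_succ, sub_eq_add_neg, ← mul_neg, ← Finset.sum_neg_distrib]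
  congr 2
  rw [show dunklSign (Fin.cons s x : Fin (N + 1) → ℝ) 0 0 = 0 by simp [dunklSign], zero_mul, zero_add]
  refine Finset.sum_congr rfl fun k _ => ?_
  rw [act_swap_zero_succ]
  have hne : s ≠ x k := fun h => hs ⟨k, h.symm⟩
  by_cases hk : s ≤ x k
  · simp [dunklSign, hk, lt_of_le_of_ne hk hne]
  · simp [dunklSign, hk, show ¬s < x k from fun h => hk h.le]

theorem intervalIntegrable_ite_le {g : ℝ → ℂ} (hg : Continuous g) (a b c : ℝ) :
    IntervalIntegrable (fun s => if s ≤ c then g s else 0) MeasureTheory.volume a b := by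
  have h := intervalIntegrable_iff.1 (hg.intervalIntegrable (μ := MeasureTheory.volume) a b)
  exact intervalIntegrable_iff.2 (h.indicator (measurableSet_Iic (a := c)))

theorem integral_ite_le {g : ℝ → ℂ} {a b c : ℝ} (hab : a ≤ b) (hc : c ≤ b) :
    (∫ s in a..b, if s ≤ c then g s else 0) = if a < c then ∫ s in a..c, g s else 0 := by
  split_ifs with h
  · exact intervalIntegral.integral_indicator (f := g) ⟨h.le, hc⟩
  · rw [intervalIntegral.integral_of_le hab]
    refine MeasureTheory.setIntegral_eq_zero_of_forall_eq_zero fun s hs => if_neg fun hsc => h ?_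
    exact hs.1.trans_le hsc

/-- The differential equation is integrated with the factor $e^{i\lambda_0(x_0-s)}$ from $x_0$ to
some $M$ above all $x_k$, where $\psi$ factorizes. The finitely many exceptional points $s=x_k$ do
no harm because $\psi$ is continuous. -/
theorem psi_cons_integral_of_injective {N : ℕ} (γ : ℝ) {lam : Fin (N + 1) → ℂ}
    (hlam : Function.Injective lam) (x0 : ℝ) (x : Fin N → ℝ) :
    psi γ lam (Fin.cons x0 x : Fin (N + 1) → ℝ) =
      Complex.exp (Complex.I * lam 0 * x0) * psi γ (Fin.tail lam) x +
        γ * ∑ k, if x0 < x k then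
          ∫ t in x0..x k, Complex.exp (Complex.I * lam 0 * ((x0 - t : ℝ) : ℂ)) *
            psi γ lam (Fin.cons (x k) (Function.update x k t)) else 0 := by
  obtain ⟨M, hM⟩ : ∃ M, ∀ k, x k ≤ M := by
    obtain ⟨M, hM⟩ := (Set.finite_range x).bddAbove
    exact ⟨M, fun k => hM ⟨k, rfl⟩⟩
  wlog hx0 : x0 ≤ M generalizing M
  · exact this (max M x0) (fun k => (hM k).trans (le_max_left _ _)) (le_max_right _ _)
  set g : Fin N → ℝ → ℂ := fun k t => Complex.exp (Complex.I * lam 0 * ((x0 - t : ℝ) : ℂ)) *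
    psi γ lam (Fin.cons (x k) (Function.update x k t)) with hg
  have hgc : ∀ k, Continuous (g k) := by
    intro k
    have := (continuous_psi_cons_update γ x k).comp (continuous_const.prodMk continuous_id :
      Continuous fun t : ℝ => (lam, t))
    exact Continuous.mul (by fun_prop) this
  have hFTC := MeasureTheory.integral_eq_of_hasDerivAt_off_countable
    (fun s : ℝ => Complex.exp (Complex.I * lam 0 * ((x0 - s : ℝ) : ℂ)) *
      psi γ lam (Fin.cons s x : Fin (N + 1) → ℝ))
    (fun s => -γ * ∑ k, if s ≤ x k then g k s else 0) (a := x0) (b := M)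
    (Set.finite_range x).countable
    ((Continuous.mul (by fun_prop) (continuous_psi_cons γ lam x)).continuousOn) ?_ ?_
  · have hend : psi γ lam (Fin.cons M x : Fin (N + 1) → ℝ) =
        Complex.exp (Complex.I * lam 0 * M) * psi γ (Fin.tail lam) x := by
      conv_lhs => rw [← Fin.cons_self_tail lam]
      exact psi_cons_of_le γ _ _ hM
    simp only [hend, sub_self, Complex.ofReal_zero, mul_zero, Complex.exp_zero, one_mul] at hFTC
    rw [← mul_assoc, ← Complex.exp_add, intervalIntegral.integral_const_mul,
      intervalIntegral.integral_finsetSum] at hFTC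
    · simp only [fun k => integral_ite_le (g := g k) (a := x0) hx0 (hM k)] at hFTC
      have e : Complex.I * lam 0 * ((x0 - M : ℝ) : ℂ) + Complex.I * lam 0 * M =
        Complex.I * lam 0 * x0 := by push_cast; ring
      rw [e] at hFTC
      linear_combination hFTC
    · exact fun k _ => intervalIntegrable_ite_le (hgc k) _ _ _
  · intro s hs
    have h1 := hasDerivAt_psi_cons γ hlam x hs.2
    have h2 : HasDerivAt (fun s : ℝ => ((x0 - s : ℝ) : ℂ)) (-1) s := by
      simpa using ((hasDerivAt_id s).const_sub x0).ofReal_comp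
    have h3 := ((h2.const_mul (Complex.I * lam 0)).cexp).mul h1
    refine h3.congr_deriv ?_
    have : ∑ k, (if s ≤ x k then g k s else 0) =
        Complex.exp (Complex.I * lam 0 * ((x0 - s : ℝ) : ℂ)) *
         ∑ k, if s ≤ x k then psi γ lam (Fin.cons (x k) (Function.update x k s)) else 0 := by
      rw [Finset.mul_sum]
      refine Finset.sum_congr rfl fun k _ => ?_
      split_ifs <;> simp [hg]
    rw [this]
    ring
  · refine IntervalIntegrable.const_mul ?_ _
    have e : (fun s => ∑ k, if s ≤ x k then g k s else 0) =
        ∑ k, fun s => if s ≤ x k then g k s else 0 := by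
      ext
      rw [Finset.sum_apply]
    rw [e]
    exact IntervalIntegrable.sum _ fun k _ => intervalIntegrable_ite_le (hgc k) x0 M (x k)

theorem psi_cons_integral {N : ℕ} (γ : ℝ) (lam : Fin (N + 1) → ℂ) (x0 : ℝ) (x : Fin N → ℝ) :
    psi γ lam (Fin.cons x0 x : Fin (N + 1) → ℝ) =
      Complex.exp (Complex.I * lam 0 * x0) * psi γ (Fin.tail lam) x +
        γ * ∑ k, if x0 < x k then
          ∫ t in x0..x k, Complex.exp (Complex.I * lam 0 * ((x0 - t : ℝ) : ℂ)) *
            psi γ lam (Fin.cons (x k) (Function.update x k t)) else 0 := by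
  refine eq_of_eq_on_injective (F := fun lam => psi γ lam (Fin.cons x0 x : Fin (N + 1) → ℝ))
    (G := fun lam => Complex.exp (Complex.I * lam 0 * x0) * psi γ (Fin.tail lam) x +
        γ * ∑ k, if x0 < x k then
          ∫ t in x0..x k, Complex.exp (Complex.I * lam 0 * ((x0 - t : ℝ) : ℂ)) *
            psi γ lam (Fin.cons (x k) (Function.update x k t)) else 0) ?_ ?_
    (fun lam h => psi_cons_integral_of_injective γ h x0 x) lam
  · exact (continuous_psi γ).comp (f := fun lam : Fin (N + 1) → ℂ =>
      (lam, (Fin.cons x0 x : Fin (N + 1) → ℝ))) (Continuous.prodMk continuous_id continuous_const)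
  · refine Continuous.add (Continuous.mul (by fun_prop) ?_) (continuous_const.mul
      (continuous_finsetSum _ fun k _ => ?_))
    · refine (continuous_psi γ).comp (f := fun lam : Fin (N + 1) → ℂ => (Fin.tail lam, x))
        (Continuous.prodMk (continuous_pi fun j => continuous_apply j.succ) continuous_const)
    · split_ifs
      · refine intervalIntegral.continuous_parametric_intervalIntegral_of_continuous' ?_ _ _
        exact Continuous.mul (by fun_prop) (continuous_psi_cons_update γ x k)
      · exact continuous_const

/-! ### Iterated integrals -/

theorem continuous_iterInt {X : Type*} [TopologicalSpace X] [FirstCountableTopology X] :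
    ∀ {n : ℕ} (a b : Fin n → ℝ) {F : X → (Fin n → ℝ) → ℂ},
      (Continuous fun p : X × (Fin n → ℝ) => F p.1 p.2) → Continuous fun q => iterInt n a b (F q)
  | 0, _, _, F, hF => hF.comp (f := fun q : X => (q, Fin.elim0)) (by fun_prop)
  | n + 1, a, b, F, hF => by
    refine intervalIntegral.continuous_parametric_intervalIntegral_of_continuous'
      (f := fun q y => iterInt n (Fin.tail a) (Fin.tail b) fun ys => F q (Fin.cons y ys)) ?_ _ _
    refine continuous_iterInt (X := X × ℝ) (Fin.tail a) (Fin.tail b)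
      (F := fun q ys => F q.1 (Fin.cons q.2 ys)) ?_
    exact hF.comp (f := fun p : (X × ℝ) × (Fin n → ℝ) =>
      (p.1.1, (Fin.cons p.1.2 p.2 : Fin (n + 1) → ℝ)))
      ((continuous_fst.comp continuous_fst).prodMk
        (Continuous.finCons (continuous_snd.comp continuous_fst) continuous_snd))

theorem iterInt_const_mul : ∀ {n : ℕ} (a b : Fin n → ℝ) (c : ℂ) (F : (Fin n → ℝ) → ℂ),
    iterInt n a b (fun y => c * F y) = c * iterInt n a b F
  | 0, _, _, _, _ => rfl
  | n + 1, a, b, c, F => by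
    simp only [iterInt, iterInt_const_mul, intervalIntegral.integral_const_mul]

/-- The order of integration in an iterated integral may be changed so that the last variable comes
first. -/
theorem iterInt_snoc : ∀ {n : ℕ} (a b : Fin (n + 1) → ℝ) {F : (Fin (n + 1) → ℝ) → ℂ},
    Continuous F → iterInt (n + 1) a b F =
      ∫ y in a (Fin.last n)..b (Fin.last n),
        iterInt n (Fin.init a) (Fin.init b) fun ys => F (Fin.snoc ys y)
  | 0, a, b, F, _ => by
    have e : ∀ y : ℝ, (Fin.cons y Fin.elim0 : Fin 1 → ℝ) = Fin.snoc Fin.elim0 y := by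
      intro y
      ext j
      rw [Fin.fin_one_eq_zero j]
      rfl
    simp only [iterInt, e]
    rfl
  | n + 1, a, b, F, hF => by
    rw [iterInt]
    have h1 : ∀ y, iterInt (n + 1) (Fin.tail a) (Fin.tail b) (fun ys => F (Fin.cons y ys)) =
        ∫ z in a (Fin.last _)..b (Fin.last _),
          iterInt n (Fin.init (Fin.tail a)) (Fin.init (Fin.tail b)) fun ys =>
            F (Fin.cons y (Fin.snoc ys z)) := fun y =>
      iterInt_snoc _ _ (hF.comp (Continuous.finCons continuous_const continuous_id))
    simp only [h1]
    -- Fubini applies: the inner integral is continuous in the two variables, hence integrable on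
    -- the compact rectangle.
    rw [MeasureTheory.intervalIntegral_intervalIntegral_swap]
    · simp only [iterInt, Fin.cons_snoc_eq_snoc_cons]
      rfl
    · have hc : Continuous (Function.uncurry fun (y z : ℝ) =>
          iterInt n (Fin.init (Fin.tail a)) (Fin.init (Fin.tail b)) fun ys =>
            F (Fin.cons y (Fin.snoc ys z))) := by
        refine continuous_iterInt (X := ℝ × ℝ) _ _
          (F := fun q ys => F (Fin.cons q.1 (Fin.snoc ys q.2))) ?_
        refine hF.comp (Continuous.finCons (continuous_fst.comp continuous_fst) ?_)
        exact Continuous.finSnoc continuous_snd (continuous_snd.comp continuous_fst)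
      refine (hc.continuousOn.integrableOn_compact ((isCompact_uIcc (a := a 0) (b := b 0)).prod
        (isCompact_uIcc (a := a (Fin.last _)) (b := b (Fin.last _))))).mono_set ?_
      exact Set.prod_mono Set.uIoc_subset_uIcc Set.uIoc_subset_uIcc

/-! ### The integral equation for the creation operator -/

theorem continuous_extend {N n : ℕ} (i : Fin n → Fin N) :
    Continuous fun p : (Fin n → ℝ) × (Fin N → ℝ) => Function.extend i p.1 p.2 := by
  refine continuous_pi fun j => ?_
  simp only [Function.extend]
  split_ifs <;> fun_prop

theorem chainPlus_cons {N n : ℕ} (i : Fin n → Fin N) (x0 : ℝ) (x : Fin N → ℝ) :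
    chainPlus i (Fin.cons x0 x) = Fin.snoc (x ∘ i) x0 := by
  simp only [chainPlus, Fin.cons_succ, Fin.cons_zero]
  rfl

theorem elemPlus_cons {N n : ℕ} (μ : ℂ) (i : Fin n → Fin N) (f : (Fin N → ℝ) → ℂ) (x0 : ℝ)
    (x : Fin N → ℝ) :
    elemPlus μ i f (Fin.cons x0 x) =
      open Classical in
      if StrictAnti (Fin.snoc (x ∘ i) x0 : Fin (n + 1) → ℝ) then
        Complex.exp (Complex.I * μ * x0) *
          iterInt n (fun m => (Fin.snoc (x ∘ i) x0 : Fin (n + 1) → ℝ) m.succ)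
            (fun m => (Fin.snoc (x ∘ i) x0 : Fin (n + 1) → ℝ) m.castSucc) fun y =>
              (∏ m, Complex.exp (Complex.I * μ * ((x (i m) - y m : ℝ) : ℂ))) *
                f (Function.extend i y x)
      else 0 := by
  simp only [elemPlus, chainPlus_cons, Fin.cons_succ, Fin.cons_zero, Fin.tail_cons]

theorem strictAnti_snoc {n : ℕ} (c : Fin (n + 1) → ℝ) (t : ℝ) :
    StrictAnti (Fin.snoc c t : Fin (n + 2) → ℝ) ↔ StrictAnti c ∧ t < c (Fin.last n) := by
  rw [Fin.strictAnti_iff_succ_lt, Fin.strictAnti_iff_succ_lt, Fin.forall_fin_succ']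
  simp only [Fin.succ_last, Fin.snoc_last, Fin.snoc_castSucc, Fin.succ_castSucc]

theorem update_comp_of_notMem {N n : ℕ} {i : Fin n → Fin N} {k : Fin N} (hk : ∀ m, i m ≠ k)
    (x : Fin N → ℝ) (t : ℝ) : Function.update x k t ∘ i = x ∘ i := by
  ext m
  simp [hk m]

/-- As `k` does not occur in `i`, neither the step function nor the limits of integration depend on
`t`. -/
theorem continuous_elemPlus_update {N n : ℕ} (μ : ℂ) {i : Fin n → Fin N} {k : Fin N}
    (hk : ∀ m, i m ≠ k) {f : (Fin N → ℝ) → ℂ} (hf : Continuous f) (x0 : ℝ) (x : Fin N → ℝ) :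
    Continuous fun t => elemPlus μ i f (Fin.cons x0 (Function.update x k t)) := by
  simp only [elemPlus_cons, update_comp_of_notMem hk]
  split_ifs
  · refine continuous_const.mul (continuous_iterInt _ _ (F := fun (t : ℝ) y =>
      (∏ m, Complex.exp (Complex.I * μ * ((Function.update x k t (i m) - y m : ℝ) : ℂ))) *
        f (Function.extend i y (Function.update x k t))) ?_)
    have hu : Continuous fun p : ℝ × (Fin n → ℝ) => Function.update x k p.1 :=
      continuous_const.update k continuous_fst
    refine Continuous.mul (by fun_prop) (hf.comp ?_)
    exact (continuous_extend i).comp (f := fun p : ℝ × (Fin n → ℝ) => (p.2, Function.update x k p.1))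
      (continuous_snd.prodMk hu)
  · exact continuous_const

theorem extend_snoc {N n : ℕ} {i : Fin n → Fin N} {k : Fin N}
    (h : Function.Injective (Fin.snoc i k : Fin (n + 1) → Fin N)) (y : Fin n → ℝ) (t : ℝ)
    (x : Fin N → ℝ) :
    Function.extend (Fin.snoc i k : Fin (n + 1) → Fin N) (Fin.snoc y t : Fin (n + 1) → ℝ) x =
      Function.extend i y (Function.update x k t) := by
  obtain ⟨hi, hk⟩ := Fin.snoc_injective_iff.1 h
  ext j
  by_cases hj : j ∈ Set.range i
  · obtain ⟨m, rfl⟩ := hj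
    rw [hi.extend_apply]
    have := h.extend_apply (Fin.snoc y t : Fin (n + 1) → ℝ) x m.castSucc
    rwa [Fin.snoc_castSucc, Fin.snoc_castSucc] at this
  · rw [Function.extend_apply' _ _ _ hj]
    by_cases hjk : j = k
    · subst hjk
      have := h.extend_apply (Fin.snoc y t : Fin (n + 1) → ℝ) x (Fin.last n)
      rw [Fin.snoc_last, Fin.snoc_last] at this
      rw [this, Function.update_self]
    · rw [Function.update_of_ne hjk, Function.extend_apply']
      rintro ⟨m, hm⟩
      cases m using Fin.lastCases with
      | last => exact hjk (by rw [← hm, Fin.snoc_last])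
      | cast m => exact hj ⟨m, by rw [← hm, Fin.snoc_castSucc]⟩

/-- The variable of the last label runs over $[x_0,x_k]$. With it outermost, the remaining integrals
are those of the shorter tuple with $x_k$ as first coordinate and $t$ in its former place. -/
theorem elemPlus_snoc {N n : ℕ} (μ : ℂ) {i : Fin n → Fin N} {k : Fin N}
    (h : Function.Injective (Fin.snoc i k : Fin (n + 1) → Fin N)) {f : (Fin N → ℝ) → ℂ}
    (hf : Continuous f) (x0 : ℝ) (x : Fin N → ℝ) :
    elemPlus μ (Fin.snoc i k : Fin (n + 1) → Fin N) f (Fin.cons x0 x) =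
      if x0 < x k then ∫ t in x0..x k, Complex.exp (Complex.I * μ * ((x0 - t : ℝ) : ℂ)) *
        elemPlus μ i f (Fin.cons (x k) (Function.update x k t)) else 0 := by
  have hk : ∀ m, i m ≠ k := fun m hm => (Fin.snoc_injective_iff.1 h).2 ⟨m, hm⟩
  have e : x ∘ (Fin.snoc i k : Fin (n + 1) → Fin N) = Fin.snoc (x ∘ i) (x k) := Fin.comp_snoc x i k
  simp only [elemPlus_cons, e, update_comp_of_notMem hk, strictAnti_snoc, Fin.snoc_last]
  by_cases h1 : x0 < x k
  swap
  · rw [if_neg fun h' => h1 h'.2, if_neg h1]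
  rw [if_pos h1]
  by_cases h2 : StrictAnti (Fin.snoc (x ∘ i) (x k) : Fin (n + 1) → ℝ)
  swap
  · rw [if_neg fun h' => h2 h'.1]
    simp [h2]
  rw [if_pos ⟨h2, h1⟩]
  simp only [if_pos h2]
  rw [iterInt_snoc]
  · simp only [Fin.succ_last, Fin.snoc_last, Fin.snoc_castSucc, Fin.prod_univ_castSucc, extend_snoc h]
    rw [← intervalIntegral.integral_const_mul]
    refine intervalIntegral.integral_congr fun t _ => ?_
    have hu : ∀ m, Function.update x k t (i m) = x (i m) := fun m => Function.update_of_ne (hk m) _ _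
    simp only [hu, ← mul_assoc, ← Complex.exp_add]
    rw [← iterInt_const_mul, ← iterInt_const_mul]
    have ea : (Fin.init fun m : Fin (n + 1) => (Fin.snoc (Fin.snoc (x ∘ i) (x k) : Fin (n + 1) → ℝ) x0 :
        Fin (n + 2) → ℝ) m.succ) = fun m => (Fin.snoc (x ∘ i) (x k) : Fin (n + 1) → ℝ) m.succ := by
      ext m
      rw [Fin.init, Fin.succ_castSucc, Fin.snoc_castSucc]
    have eb : (Fin.init fun m : Fin (n + 1) => (Fin.snoc (x ∘ i) (x k) : Fin (n + 1) → ℝ) m) =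
        fun m => (x ∘ i) m := by
      ext m
      rw [Fin.init, Fin.snoc_castSucc]
    rw [ea, eb]
    congr 1
    ext ys
    have hE : Complex.exp (Complex.I * μ * ((x0 - t : ℝ) : ℂ) + Complex.I * μ * (x k : ℂ)) =
        Complex.exp (Complex.I * μ * x0) * Complex.exp (Complex.I * μ * ((x k - t : ℝ) : ℂ)) := by
      rw [← Complex.exp_add]
      congr 1
      push_cast
      ring
    rw [hE]
    ring
  · refine Continuous.mul (by fun_prop) (hf.comp ?_)
    exact (continuous_extend _).comp (f := fun y => (y, x)) (by fun_prop)

/-- The chain condition would require the entry $t$ at `k` to exceed the first coordinate $x_k$.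
Thus tuples containing `k` drop out in `bPlus_cons_update`. -/
theorem elemPlus_eq_zero {N n : ℕ} (μ : ℂ) {i : Fin n → Fin N} {k : Fin N} (m : Fin n)
    (hm : i m = k) (f : (Fin N → ℝ) → ℂ) (x : Fin N → ℝ) {t : ℝ} (ht : t ≤ x k) :
    elemPlus μ i f (Fin.cons (x k) (Function.update x k t)) = 0 := by
  rw [elemPlus_cons, if_neg]
  intro h
  have := h (Fin.castSucc_lt_last m)
  rw [Fin.snoc_last, Fin.snoc_castSucc, Function.comp_apply, hm, Function.update_self] at this
  exact this.not_ge ht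

theorem sum_injTuples_succ {N n : ℕ} (E : (Fin (n + 1) → Fin N) → ℂ) :
    ∑ i ∈ injTuples (n + 1) N, E i = open Classical in ∑ k : Fin N, ∑ i : Fin n → Fin N,
      if Function.Injective (Fin.snoc i k : Fin (n + 1) → Fin N) then E (Fin.snoc i k) else 0 := by
  classical
  rw [injTuples, Finset.sum_filter, ← (Fin.snocEquiv fun _ => Fin N).sum_comp, Fintype.sum_prod_type]
  refine Finset.sum_congr rfl fun k _ => Finset.sum_congr rfl fun i _ => ?_
  rfl

theorem bPlus_cons_update {N : ℕ} (γ : ℝ) (μ : ℂ) (f : (Fin N → ℝ) → ℂ) (x : Fin N → ℝ) (k : Fin N)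
    {t : ℝ} (ht : t ≤ x k) :
    bPlus γ μ f (Fin.cons (x k) (Function.update x k t)) =
      open Classical in ∑ n ∈ range N, (γ : ℂ) ^ n * ∑ i : Fin n → Fin N,
        if Function.Injective (Fin.snoc i k : Fin (n + 1) → Fin N) then
          elemPlus μ i f (Fin.cons (x k) (Function.update x k t)) else 0 := by
  classical
  rw [bPlus, Finset.sum_range_succ]
  have hlast : ∑ i ∈ injTuples N N, elemPlus μ i f (Fin.cons (x k) (Function.update x k t)) = 0 := by
    refine Finset.sum_eq_zero fun i hi => ?_
    obtain ⟨m, hm⟩ := (Finite.injective_iff_surjective.1 (Finset.mem_filter.1 hi).2) k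
    exact elemPlus_eq_zero μ m hm f x ht
  rw [hlast, mul_zero, add_zero]
  refine Finset.sum_congr rfl fun n _ => ?_
  congr 1
  rw [injTuples, Finset.sum_filter]
  refine Finset.sum_congr rfl fun i _ => ?_
  by_cases hi : Function.Injective i
  · rw [if_pos hi]
    by_cases hk : k ∈ Set.range i
    · obtain ⟨m, hm⟩ := hk
      rw [elemPlus_eq_zero μ m hm f x ht, ite_self]
    · rw [if_pos (Fin.snoc_injective_iff.2 ⟨hi, hk⟩)]
  · rw [if_neg hi, if_neg fun h => hi (Fin.snoc_injective_iff.1 h).1]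

/-- The empty tuple gives the first term; the others are grouped by their last label `k` through
`elemPlus_snoc`. The equation has the form of `psi_cons_integral`. -/
theorem bPlus_cons_integral {N : ℕ} (γ : ℝ) (μ : ℂ) {f : (Fin N → ℝ) → ℂ} (hf : Continuous f)
    (x0 : ℝ) (x : Fin N → ℝ) :
    bPlus γ μ f (Fin.cons x0 x) = Complex.exp (Complex.I * μ * x0) * f x +
      γ * ∑ k, if x0 < x k then
        ∫ t in x0..x k, Complex.exp (Complex.I * μ * ((x0 - t : ℝ) : ℂ)) *
          bPlus γ μ f (Fin.cons (x k) (Function.update x k t)) else 0 := by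
  classical
  have hk : ∀ k, (if x0 < x k then
        ∫ t in x0..x k, Complex.exp (Complex.I * μ * ((x0 - t : ℝ) : ℂ)) *
          bPlus γ μ f (Fin.cons (x k) (Function.update x k t)) else 0) =
      ∑ n ∈ range N, (γ : ℂ) ^ n * ∑ i : Fin n → Fin N,
        if Function.Injective (Fin.snoc i k : Fin (n + 1) → Fin N) then
          elemPlus μ (Fin.snoc i k : Fin (n + 1) → Fin N) f (Fin.cons x0 x) else 0 := by
    intro k
    split_ifs with h
    · have hcont : ∀ (n : ℕ) (i : Fin n → Fin N), Continuous fun t : ℝ =>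
          if Function.Injective (Fin.snoc i k : Fin (n + 1) → Fin N) then
            Complex.exp (Complex.I * μ * ((x0 - t : ℝ) : ℂ)) *
              elemPlus μ i f (Fin.cons (x k) (Function.update x k t)) else 0 := by
        intro n i
        split_ifs with hi
        · exact Continuous.mul (by fun_prop) (continuous_elemPlus_update μ
            (fun m hm => (Fin.snoc_injective_iff.1 hi).2 ⟨m, hm⟩) hf _ x)
        · exact continuous_const
      have e1 : (∫ t in x0..x k, Complex.exp (Complex.I * μ * ((x0 - t : ℝ) : ℂ)) *
          bPlus γ μ f (Fin.cons (x k) (Function.update x k t))) =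
          ∫ t in x0..x k, ∑ n ∈ range N, (γ : ℂ) ^ n * ∑ i : Fin n → Fin N,
            if Function.Injective (Fin.snoc i k : Fin (n + 1) → Fin N) then
            Complex.exp (Complex.I * μ * ((x0 - t : ℝ) : ℂ)) *
              elemPlus μ i f (Fin.cons (x k) (Function.update x k t)) else 0 := by
        refine intervalIntegral.integral_congr fun t ht => ?_
        rw [Set.uIcc_of_le h.le] at ht
        rw [bPlus_cons_update γ μ f x k ht.2, Finset.mul_sum]
        refine Finset.sum_congr rfl fun n _ => ?_
        rw [mul_left_comm, Finset.mul_sum]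
        simp only [mul_ite, mul_zero]
      rw [e1, intervalIntegral.integral_finsetSum]
      · refine Finset.sum_congr rfl fun n _ => ?_
        rw [intervalIntegral.integral_const_mul, intervalIntegral.integral_finsetSum]
        · congr 1
          refine Finset.sum_congr rfl fun i _ => ?_
          split_ifs with hi
          · rw [elemPlus_snoc μ hi hf, if_pos h]
          · simp
        · exact fun i _ => (hcont n i).intervalIntegrable _ _
      · intro n _
        exact (continuous_const.mul (continuous_finsetSum _ fun i _ => hcont n i)).intervalIntegrable _ _
    · refine (Finset.sum_eq_zero fun n _ => mul_eq_zero_of_right _ (Finset.sum_eq_zero fun i _ => ?_)).symm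
      split_ifs with hi
      · rw [elemPlus_snoc μ hi hf, if_neg h]
      · rfl
  simp only [hk]
  rw [bPlus, Finset.sum_range_succ', add_comm]
  congr 1
  · have : injTuples 0 N = univ := by
      ext i
      simp [injTuples, Function.injective_of_subsingleton]
    rw [this]
    simp [elemPlus_cons, iterInt, Subsingleton.strictAnti]
    congr 1
    ext j
    exact Function.extend_apply' _ _ _ (by simp)
  · rw [Finset.sum_comm, Finset.mul_sum]
    refine Finset.sum_congr rfl fun n _ => ?_
    rw [sum_injTuples_succ, ← Finset.mul_sum, pow_succ]
    ring

/-- The creation operator maps wavefunctions to wavefunctions. -/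
theorem bPlus_psi {N : ℕ} (γ : ℝ) (μ : ℂ) (lam : Fin N → ℂ) (x0 : ℝ) (x : Fin N → ℝ) :
    bPlus γ μ (psi γ lam) (Fin.cons x0 x) =
      psi γ (Fin.cons μ lam) (Fin.cons x0 x : Fin (N + 1) → ℝ) := by
  have hc : Continuous (psi γ lam) :=
    (continuous_psi γ).comp (f := fun x : Fin N → ℝ => (lam, x)) (by fun_prop)
  -- In the integrand the first coordinate is $x_k>x_0$ and the entry at `k` is $t\le x_k$, so the
  -- set of coordinates above the first one loses `k` and gains nothing.
  induction h : (univ.filter fun k => x0 < x k).card using Nat.strong_induction_on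
    generalizing x0 x with
  | _ n ih =>
  rw [bPlus_cons_integral γ μ hc, psi_cons_integral]
  simp only [Fin.cons_zero, Fin.tail_cons]
  congr 2
  refine Finset.sum_congr rfl fun k _ => ?_
  split_ifs with hk
  swap
  · rfl
  refine intervalIntegral.integral_congr fun t ht => ?_
  rw [Set.uIcc_of_le hk.le] at ht
  rw [ih _ ?_ _ _ rfl]
  rw [← h]
  refine Finset.card_lt_card ⟨fun j hj => ?_, fun hs => ?_⟩
  · rw [Finset.mem_filter] at hj ⊢
    refine ⟨hj.1, ?_⟩
    by_cases hjk : j = k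
    · rwa [hjk]
    · rw [Function.update_of_ne hjk] at hj
      exact hk.trans hj.2
  · have := hs (Finset.mem_filter.2 ⟨mem_univ k, hk⟩)
    rw [Finset.mem_filter, Function.update_self] at this
    exact this.2.not_ge ht.2

/-! ### The Bethe-type expansion -/

theorem incTuples_filter_ne_zero (n N : ℕ) :
    (incTuples n (N + 1)).filter (fun i => ∀ m, i m ≠ 0) =
      (incTuples n N).image fun i m => (i m).succ := by
  ext i
  simp only [incTuples, mem_filter, mem_univ, true_and, mem_image]
  constructor
  · rintro ⟨hi, h0⟩
    refine ⟨fun m => (i m).pred (h0 m), fun m m' h => ?_, by simp⟩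
    exact Fin.pred_lt_pred_iff.2 (hi h)
  · rintro ⟨j, hj, rfl⟩
    exact ⟨fun m m' h => Fin.succ_lt_succ_iff.2 (hj h), fun m => Fin.succ_ne_zero _⟩

theorem incTuples_filter_not_ne_zero (n N : ℕ) :
    (incTuples (n + 1) (N + 1)).filter (fun i => ¬∀ m, i m ≠ 0) =
      (incTuples n N).image fun i => (Fin.cons 0 fun m => (i m).succ) := by
  ext i
  simp only [incTuples, mem_filter, mem_univ, true_and, mem_image]
  constructor
  · rintro ⟨hi, h0⟩
    have hi0 : i 0 = 0 := by
      push Not at h0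
      obtain ⟨m, hm⟩ := h0
      exact le_antisymm (hm ▸ hi.monotone (Fin.zero_le m)) (Fin.zero_le _)
    have hs : ∀ m : Fin n, i m.succ ≠ 0 := fun m h =>
      (hi (Fin.succ_pos m)).ne (hi0.trans h.symm)
    refine ⟨fun m => (i m.succ).pred (hs m), fun m m' h => ?_, ?_⟩
    · exact Fin.pred_lt_pred_iff.2 (hi (Fin.succ_lt_succ_iff.2 h))
    · ext m
      cases m using Fin.cases with
      | zero => simp [hi0]
      | succ m => simp
  · rintro ⟨j, hj, rfl⟩
    refine ⟨?_, fun h => h 0 rfl⟩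
    intro m m' h
    cases m' using Fin.cases with
    | zero => exact absurd h (Fin.not_lt_zero _)
    | succ m' =>
      cases m using Fin.cases with
      | zero => simp
      | succ m => simpa using hj (Fin.succ_lt_succ_iff.1 h)

theorem incTuples_eq_empty (N : ℕ) : incTuples (N + 1) N = ∅ := by
  refine Finset.eq_empty_of_forall_notMem fun i hi => ?_
  have := Fintype.card_le_of_injective i (Finset.mem_filter.1 hi).2.injective
  simp at this

theorem sum_incTuples_succ {N : ℕ} (g : (n : ℕ) → (Fin n → Fin (N + 1)) → ℂ) :
    ∑ n ∈ range (N + 2), ∑ i ∈ incTuples n (N + 1), g n i =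
      ∑ n ∈ range (N + 1), ∑ i ∈ incTuples n N,
        (g n (fun m => (i m).succ) + g (n + 1) (Fin.cons 0 fun m => (i m).succ)) := by
  have hA : ∀ n, ∑ i ∈ (incTuples n (N + 1)).filter (fun i => ∀ m, i m ≠ 0), g n i =
      ∑ i ∈ incTuples n N, g n (fun m => (i m).succ) := by
    intro n
    rw [incTuples_filter_ne_zero, Finset.sum_image]
    intro i _ j _ h
    ext m
    simpa using congrArg Fin.val (congrFun h m)
  have hB : ∀ n, ∑ i ∈ (incTuples (n + 1) (N + 1)).filter (fun i => ¬∀ m, i m ≠ 0), g (n + 1) i =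
      ∑ i ∈ incTuples n N, g (n + 1) (Fin.cons 0 fun m => (i m).succ) := by
    intro n
    rw [incTuples_filter_not_ne_zero, Finset.sum_image]
    intro i _ j _ h
    ext m
    simpa using congrArg Fin.val (congrFun h m.succ)
  have h0 : ∑ i ∈ incTuples 0 (N + 1), g 0 i = ∑ i ∈ incTuples 0 N, g 0 (fun m => (i m).succ) := by
    rw [← hA, Finset.filter_true_of_mem]
    exact fun i _ m => m.elim0
  have hS : ∀ n, ∑ i ∈ incTuples (n + 1) (N + 1), g (n + 1) i =
      ∑ i ∈ incTuples (n + 1) N, g (n + 1) (fun m => (i m).succ) +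
        ∑ i ∈ incTuples n N, g (n + 1) (Fin.cons 0 fun m => (i m).succ) := by
    intro n
    rw [← hA, ← hB, Finset.sum_filter_add_sum_filter_not]
  rw [Finset.sum_range_succ']
  simp only [hS, h0, Finset.sum_add_distrib]
  rw [add_right_comm, ← Finset.sum_range_succ' fun n =>
    ∑ i ∈ incTuples n N, g n (fun m => (i m).succ)]
  -- The surplus term has length `N + 1` among `N` labels.
  rw [Finset.sum_range_succ _ (N + 1), incTuples_eq_empty, Finset.sum_empty, add_zero]

theorem extend_succ {N n : ℕ} {i : Fin n → Fin N} (hi : Function.Injective i) (u : Fin n → ℂ)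
    (c : ℂ) (v : Fin N → ℂ) :
    Function.extend (fun m => (i m).succ) u (Fin.cons c v : Fin (N + 1) → ℂ) =
      Fin.cons c (Function.extend i u v) := by
  have hi' : Function.Injective fun m => (i m).succ := (Fin.succ_injective _).comp hi
  ext j
  cases j using Fin.cases with
  | zero =>
    rw [Function.extend_apply', Fin.cons_zero, Fin.cons_zero]
    rintro ⟨m, hm⟩
    exact Fin.succ_ne_zero _ hm
  | succ j =>
    rw [Fin.cons_succ]
    by_cases hj : ∃ m, i m = j
    · obtain ⟨m, rfl⟩ := hj
      rw [hi.extend_apply, hi'.extend_apply (f := fun m => (i m).succ)]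
    · rw [Function.extend_apply' _ _ _ hj, Function.extend_apply', Fin.cons_succ]
      rintro ⟨m, hm⟩
      exact hj ⟨m, Fin.succ_injective _ hm⟩

theorem extend_cons_zero {N n : ℕ} {i : Fin n → Fin N} (hi : Function.Injective i) (u : Fin n → ℂ)
    (b c : ℂ) (v : Fin N → ℂ) :
    Function.extend (Fin.cons 0 fun m => (i m).succ : Fin (n + 1) → Fin (N + 1))
      (Fin.cons b u : Fin (n + 1) → ℂ) (Fin.cons c v : Fin (N + 1) → ℂ) =
      Fin.cons b (Function.extend i u v) := by
  have hi' : Function.Injective (Fin.cons 0 fun m => (i m).succ : Fin (n + 1) → Fin (N + 1)) :=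
    Fin.cons_injective_iff.2 ⟨by rintro ⟨m, hm⟩; exact Fin.succ_ne_zero _ hm,
      (Fin.succ_injective _).comp hi⟩
  ext j
  cases j using Fin.cases with
  | zero => exact hi'.extend_apply (Fin.cons b u : Fin (n + 1) → ℂ) _ 0
  | succ j =>
    rw [Fin.cons_succ]
    by_cases hj : ∃ m, i m = j
    · obtain ⟨m, rfl⟩ := hj
      rw [hi.extend_apply]
      exact hi'.extend_apply (Fin.cons b u : Fin (n + 1) → ℂ) _ m.succ
    · rw [Function.extend_apply' _ _ _ hj, Function.extend_apply', Fin.cons_succ]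
      rintro ⟨m, hm⟩
      cases m using Fin.cases with
      | zero => exact Fin.succ_ne_zero _ hm.symm
      | succ m => exact hj ⟨m, Fin.succ_injective _ hm⟩

theorem shiftPlus_shift {N n : ℕ} {i : Fin n → Fin N} (hi : Function.Injective i) (c : ℂ)
    (lam : Fin N → ℂ) (μ : ℂ) :
    shiftPlus (Fin.cons c lam : Fin (N + 1) → ℂ) μ (fun m => (i m).succ) =
      Fin.cons c (shiftPlus lam μ i) := by
  simp only [shiftPlus, Fin.cons_succ, extend_succ hi]

/-- When label `0` belongs to the tuple, `μ` settles there and `c` is carried on in its place. -/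
theorem shiftPlus_cons {N n : ℕ} {i : Fin n → Fin N} (hi : Function.Injective i) (c : ℂ)
    (lam : Fin N → ℂ) (μ : ℂ) :
    shiftPlus (Fin.cons c lam : Fin (N + 1) → ℂ) μ
        (Fin.cons 0 fun m => (i m).succ : Fin (n + 1) → Fin (N + 1)) =
      Fin.cons μ (shiftPlus lam c i) := by
  have e : (fun k => (Fin.cons c lam : Fin (N + 1) → ℂ)
      ((Fin.cons 0 fun m => (i m).succ : Fin (n + 1) → Fin (N + 1)) k)) =
      Fin.cons c fun k => lam (i k) := by
    ext k
    cases k using Fin.cases <;> simp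
  have e' : (fun m : Fin (n + 1) => (Fin.cons μ (Fin.cons c fun k => lam (i k) : Fin (n + 1) → ℂ) :
      Fin (n + 2) → ℂ) m.castSucc) =
      Fin.cons μ fun m => (Fin.cons c fun k => lam (i k) : Fin (n + 1) → ℂ) m.castSucc := by
    ext m
    cases m using Fin.cases with
    | zero => simp
    | succ m => rw [Fin.castSucc_succ, Fin.cons_succ, Fin.cons_succ]
  rw [shiftPlus, e, e', extend_cons_zero hi, shiftPlus]

theorem cons_comp_swap_succ {N : ℕ} (a : Adj N) (c : ℂ) (lam : Fin N → ℂ) :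
    (Fin.cons c lam : Fin (N + 1) → ℂ) ∘ Equiv.swap a.succ.1.1 a.succ.1.2 =
      Fin.cons c (lam ∘ Equiv.swap a.1.1 a.1.2) := by
  ext j
  cases j using Fin.cases with
  | zero =>
    simp [Adj.succ, Equiv.swap_apply_of_ne_of_ne (Fin.succ_ne_zero _).symm (Fin.succ_ne_zero _).symm]
  | succ j => simp [Adj.succ, swap_succ_apply]

theorem cons_cons_swap {R : Type*} {N : ℕ} (b c : R) (v : Fin N → R) (j : Fin (N + 2)) :
    (Fin.cons b (Fin.cons c v : Fin (N + 1) → R) : Fin (N + 2) → R) (Equiv.swap 0 1 j) =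
      (Fin.cons c (Fin.cons b v : Fin (N + 1) → R) : Fin (N + 2) → R) j := by
  cases j using Fin.cases with
  | zero => rw [Equiv.swap_apply_left]; rfl
  | succ j =>
    cases j using Fin.cases with
    | zero => rw [Fin.succ_zero_eq_one, Equiv.swap_apply_right]; rfl
    | succ j =>
      rw [Equiv.swap_apply_of_ne_of_ne (Fin.succ_ne_zero _)]
      · rfl
      · rw [← Fin.succ_zero_eq_one]
        exact fun h => Fin.succ_ne_zero _ (Fin.succ_injective _ h)

/-- A general `F` with the exchange relation replaces $\psi$, so that the induction can freeze the
first parameter and the first coordinate once $x_0$ has passed it. The terms in which `μ` or `c`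
travels on match tuples without or with label `0`; their weights are
$1+\frac{i\gamma}{\mu-c}=\frac{c-\mu-i\gamma}{c-\mu}$ and
$-\frac{i\gamma}{\mu-c}=\frac{i\gamma}{c-\mu}$. -/
theorem bethe_expansion (γ : ℝ) (x0 : ℝ) : ∀ (N : ℕ)
    (F : (Fin (N + 1) → ℂ) → (Fin (N + 1) → ℝ) → ℂ)
    (_ : ∀ (lam : Fin (N + 1) → ℂ) (a : Adj (N + 1)), lam a.1.1 ≠ lam a.1.2 → ∀ y,
      F lam (act (Equiv.swap a.1.1 a.1.2) y) =
        (1 + Complex.I * γ / (lam a.1.1 - lam a.1.2)) * F (lam ∘ Equiv.swap a.1.1 a.1.2) y -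
          Complex.I * γ / (lam a.1.1 - lam a.1.2) * F lam y)
    (φ : (Fin N → ℂ) → ℂ) (x : Fin N → ℝ)
    (_ : ∀ (lam : Fin N → ℂ) ν,
      F (Fin.snoc lam ν) (Fin.snoc x x0) = Complex.exp (Complex.I * ν * x0) * φ lam)
    (lam : Fin N → ℂ) (μ : ℂ), Generic lam μ →
    F (Fin.cons μ lam) (Fin.cons x0 x) =
      ∑ n ∈ range (N + 1), ∑ i ∈ incTuples n N,
        coeffPlus γ x0 lam μ i * φ (shiftPlus lam μ i)
  | 0, F, _, φ, x, hφ, lam, μ, _ => by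
    have e1 : (Fin.cons μ lam : Fin 1 → ℂ) = Fin.snoc lam μ := by
      ext j
      rw [Fin.fin_one_eq_zero j]
      rfl
    have e2 : (Fin.cons x0 x : Fin 1 → ℝ) = Fin.snoc x x0 := by
      ext j
      rw [Fin.fin_one_eq_zero j]
      rfl
    have e3 : incTuples 0 0 = univ := by
      ext i
      simp [incTuples, Subsingleton.strictMono]
    rw [e1, e2, hφ, Finset.sum_range_one, e3, Fintype.sum_unique, coeffPlus_empty]
    congr 2
    exact Subsingleton.elim _ _
  | N + 1, F, hF, φ, x, hφ, lam, μ, hg => by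
    induction lam using Fin.consCases with | _ c lam
    induction x using Fin.consCases with | _ x1 x
    have hcμ : c ≠ μ := hg.2 0
    have hg1 : Generic lam μ :=
      ⟨fun j k h => Fin.succ_injective _ (hg.1 (by simpa using h)), fun j => hg.2 j.succ⟩
    have hg2 : Generic lam c :=
      ⟨hg1.1, fun j h => Fin.succ_ne_zero j (hg.1 (by simpa using h))⟩
    have hF' : ∀ (d : ℂ) (lam : Fin (N + 1) → ℂ) (a : Adj (N + 1)), lam a.1.1 ≠ lam a.1.2 → ∀ y,
      F (Fin.cons d lam) (Fin.cons x1 (act (Equiv.swap a.1.1 a.1.2) y)) =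
        (1 + Complex.I * γ / (lam a.1.1 - lam a.1.2)) *
          F (Fin.cons d (lam ∘ Equiv.swap a.1.1 a.1.2)) (Fin.cons x1 y) -
          Complex.I * γ / (lam a.1.1 - lam a.1.2) * F (Fin.cons d lam) (Fin.cons x1 y) := by
      intro d lam a h y
      have := hF (Fin.cons d lam) a.succ (by simpa [Adj.succ] using h) (Fin.cons x1 y)
      rw [act_succ_cons, cons_comp_swap_succ] at this
      simpa [Adj.succ] using this
    have hφ' : ∀ (d : ℂ) (lam : Fin N → ℂ) ν,
        F (Fin.cons d (Fin.snoc lam ν : Fin (N + 1) → ℂ))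
          (Fin.cons x1 (Fin.snoc x x0 : Fin (N + 1) → ℝ)) =
          Complex.exp (Complex.I * ν * x0) * φ (Fin.cons d lam) := by
      intro d lam ν
      rw [Fin.cons_snoc_eq_snoc_cons, Fin.cons_snoc_eq_snoc_cons]
      exact hφ _ _
    have i1 := bethe_expansion γ x0 N (fun lam y => F (Fin.cons c lam) (Fin.cons x1 y)) (hF' c)
      (fun lam => φ (Fin.cons c lam)) x (hφ' c) lam μ hg1
    have i2 := bethe_expansion γ x0 N (fun lam y => F (Fin.cons μ lam) (Fin.cons x1 y)) (hF' μ)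
      (fun lam => φ (Fin.cons μ lam)) x (hφ' μ) lam c hg2
    have hs := hF (Fin.cons μ (Fin.cons c lam : Fin (N + 1) → ℂ)) ⟨(0, 1), by simp⟩ hcμ.symm
      (Fin.cons x1 (Fin.cons x0 x : Fin (N + 1) → ℝ))
    have ex : act (Equiv.swap 0 1) (Fin.cons x1 (Fin.cons x0 x : Fin (N + 1) → ℝ) : Fin (N + 2) → ℝ) =
        Fin.cons x0 (Fin.cons x1 x : Fin (N + 1) → ℝ) := by
      ext j
      rw [act, Equiv.swap_inv, cons_cons_swap]
    have el : (Fin.cons μ (Fin.cons c lam : Fin (N + 1) → ℂ) : Fin (N + 2) → ℂ) ∘ Equiv.swap 0 1 =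
        Fin.cons c (Fin.cons μ lam : Fin (N + 1) → ℂ) := by
      ext j
      rw [Function.comp_apply, cons_cons_swap]
    simp only [ex, el] at hs
    rw [hs, i1, i2, sum_incTuples_succ, Finset.mul_sum, Finset.mul_sum, ← Finset.sum_sub_distrib]
    refine Finset.sum_congr rfl fun n _ => ?_
    rw [Finset.mul_sum, Finset.mul_sum, ← Finset.sum_sub_distrib]
    refine Finset.sum_congr rfl fun i hi => ?_
    have hinj : Function.Injective i := (Finset.mem_filter.1 hi).2.injective
    rw [shiftPlus_shift hinj, shiftPlus_cons hinj, coeffPlus_shift, coeffPlus_cons]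
    have h1 : (Fin.cons μ (Fin.cons c lam : Fin (N + 1) → ℂ) : Fin (N + 2) → ℂ) 1 = c := rfl
    simp only [Fin.cons_zero, h1, Fin.tail_cons]
    have hd : c - μ ≠ 0 := sub_ne_zero.2 hcμ
    rw [← neg_sub c μ]
    field_simp
    ring

/-! ### The formula for $a^+$ and its limits -/

theorem continuous_betheValue {N : ℕ} (γ xp : ℝ) (x : Fin N → ℝ) :
    Continuous fun p : (Fin N → ℂ) × ℂ =>
      psi γ (Fin.cons p.2 p.1 : Fin (N + 1) → ℂ) (Fin.cons xp x : Fin (N + 1) → ℝ) :=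
  (continuous_psi γ).comp (f := fun p : (Fin N → ℂ) × ℂ =>
    ((Fin.cons p.2 p.1 : Fin (N + 1) → ℂ), (Fin.cons xp x : Fin (N + 1) → ℝ)))
    (Continuous.prodMk (Continuous.finCons (A := fun _ : Fin (N + 1) => ℂ) continuous_snd
      continuous_fst) continuous_const)

theorem aPlus_psi_eq_betheSumPlus {N : ℕ} (γ xp : ℝ) {lam : Fin N → ℂ} {μ : ℂ} {x : Fin N → ℝ}
    (hx : ∀ j, xp ≤ x j) (hg : Generic lam μ) :
    aPlus γ xp μ (psi γ lam) x = betheSumPlus γ xp lam μ x := by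
  rw [aPlus, bPlus_psi]
  exact bethe_expansion γ xp N (psi γ) (fun lam a h y => psi_act_swap γ a h y)
    (fun lam => psi γ lam x) x (fun lam ν => psi_snoc_of_le γ ν lam hx) lam μ hg

/-- On generic parameters the sum equals $\psi_{(\mu,\bm\lambda)}(x^+,\bm x)$, which is continuous
in all parameters; the poles of the single terms cancel. -/
theorem tendsto_betheSumPlus {N : ℕ} (γ xp : ℝ) (lam : Fin N → ℂ) (μ : ℂ) {x : Fin N → ℝ}
    (hx : ∀ j, xp ≤ x j) :
    Filter.Tendsto (fun p : (Fin N → ℂ) × ℂ => betheSumPlus γ xp p.1 p.2 x)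
      (nhdsWithin (lam, μ) {p | Generic p.1 p.2}) (nhds (aPlus γ xp μ (psi γ lam) x)) := by
  have h := ((continuous_betheValue γ xp x).tendsto (lam, μ)).mono_left
    (nhdsWithin_le_nhds (s := {p | Generic p.1 p.2}))
  rw [aPlus, bPlus_psi]
  refine h.congr' ?_
  filter_upwards [self_mem_nhdsWithin] with p hp
  rw [← aPlus_psi_eq_betheSumPlus γ xp hx hp, aPlus, bPlus_psi]

/-! ### Reflection of the creation operators and of the coefficients -/

/-- The tuple of reflected labels, in reversed order. -/
def revTuple {N n : ℕ} (i : Fin n → Fin N) : Fin n → Fin N := fun m => (i m.rev).rev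

theorem revTuple_revTuple {N n : ℕ} (i : Fin n → Fin N) : revTuple (revTuple i) = i := by
  ext m
  simp [revTuple]

theorem revTuple_injective {N n : ℕ} {i : Fin n → Fin N} (hi : Function.Injective i) :
    Function.Injective (revTuple i) :=
  Fin.rev_injective.comp (hi.comp Fin.rev_injective)

theorem revTuple_strictMono {N n : ℕ} {i : Fin n → Fin N} (hi : StrictMono i) :
    StrictMono (revTuple i) := fun _ _ h => Fin.rev_lt_rev.2 (hi (Fin.rev_lt_rev.2 h))

theorem refl_refl {R : Type*} [InvolutiveNeg R] {N : ℕ} (x : Fin N → R) : refl (refl x) = x := by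
  ext j
  simp [refl]

theorem refl_snoc {R : Type*} [Neg R] {N : ℕ} (x : Fin N → R) (c : R) :
    refl (Fin.snoc x c : Fin (N + 1) → R) = Fin.cons (-c) (refl x) := by
  ext j
  cases j using Fin.cases with
  | zero => simp [refl]
  | succ j => simp [refl, Fin.rev_succ]

theorem refl_extend {R : Type*} [Neg R] {N n : ℕ} {i : Fin n → Fin N} (hi : Function.Injective i)
    (u : Fin n → R) (v : Fin N → R) :
    refl (Function.extend i u v) = Function.extend (revTuple i) (refl u) (refl v) := by
  ext j
  rw [refl]
  by_cases hj : ∃ m, i m = j.rev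
  · obtain ⟨m, hm⟩ := hj
    have hj' : j = revTuple i m.rev := by simp [revTuple, hm]
    rw [← hm, hi.extend_apply, hj', (revTuple_injective hi).extend_apply]
    simp [refl]
  · rw [Function.extend_apply' _ _ _ hj, Function.extend_apply']
    · rfl
    · rintro ⟨m, hm⟩
      exact hj ⟨m.rev, by rw [← hm]; simp [revTuple]⟩

theorem continuous_refl {N : ℕ} : Continuous fun x : Fin N → ℝ => refl x := by
  unfold refl
  fun_prop

/-- Negation exchanges lower and upper limits, and reversal of labels reverses the order of
integration; the latter is undone by `iterInt_snoc`. -/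
theorem iterInt_refl : ∀ {n : ℕ} (a b : Fin n → ℝ) {F : (Fin n → ℝ) → ℂ}, Continuous F →
    iterInt n (refl b) (refl a) (fun y => F (refl y)) = iterInt n a b F
  | 0, _, _, F, _ => congrArg F (Subsingleton.elim _ _)
  | n + 1, a, b, F, hF => by
    have hr : ∀ (ys : Fin n → ℝ) (y : ℝ),
        refl (Fin.snoc ys y : Fin (n + 1) → ℝ) = Fin.cons (-y) (refl ys) := fun ys y => refl_snoc ys y
    have ht : ∀ c : Fin (n + 1) → ℝ, Fin.init (refl c) = refl (Fin.tail c) := by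
      intro c
      ext m
      simp [Fin.init, refl, Fin.tail, Fin.rev_castSucc]
    have hl : ∀ c : Fin (n + 1) → ℝ, refl c (Fin.last n) = -c 0 := by
      intro c
      simp [refl]
    have hin : ∀ y : ℝ, iterInt n (refl (Fin.tail b)) (refl (Fin.tail a))
        (fun ys => F (Fin.cons (-y) (refl ys))) =
          iterInt n (Fin.tail a) (Fin.tail b) fun ys => F (Fin.cons (-y) ys) := fun y =>
      iterInt_refl (Fin.tail a) (Fin.tail b) (F := fun ys => F (Fin.cons (-y) ys))
        (hF.comp (Continuous.finCons continuous_const continuous_id))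
    rw [iterInt_snoc _ _ (F := fun y => F (refl y)) (hF.comp continuous_refl)]
    simp only [hr, ht, hl, hin, iterInt]
    rw [intervalIntegral.integral_comp_neg fun y =>
      iterInt n (Fin.tail a) (Fin.tail b) fun ys => F (Fin.cons y ys)]
    simp

theorem strictAnti_refl {n : ℕ} {c : Fin n → ℝ} : StrictAnti (refl c) ↔ StrictAnti c := by
  have h : ∀ c : Fin n → ℝ, StrictAnti c → StrictAnti (refl c) := fun c hc _ _ hij =>
    neg_lt_neg (hc (Fin.rev_lt_rev.2 hij))
  exact ⟨fun hc => refl_refl c ▸ h _ hc, h c⟩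

theorem chainPlus_refl {N n : ℕ} (i : Fin n → Fin N) (y : Fin (N + 1) → ℝ) :
    chainPlus (revTuple i) (refl y) = refl (chainMinus i y) := by
  ext m
  cases m using Fin.lastCases with
  | last => simp [chainPlus, chainMinus, refl]
  | cast m => simp [chainPlus, chainMinus, refl, revTuple, Fin.rev_castSucc, Fin.rev_succ]

/-- The phases depend on $\mu$ times coordinates, so negating both leaves them unchanged. -/
theorem elemMinus_eq_elemPlus {N n : ℕ} (μ : ℂ) {i : Fin n → Fin N} (hi : Function.Injective i)
    {f : (Fin N → ℝ) → ℂ} (hf : Continuous f) (y : Fin (N + 1) → ℝ) :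
    elemMinus μ i f y = elemPlus (-μ) (revTuple i) (fun z => f (refl z)) (refl y) := by
  rw [elemMinus, elemPlus, chainPlus_refl]
  simp only [strictAnti_refl]
  split_ifs
  swap
  · rfl
  congr 1
  · simp [refl]
  · rw [← iterInt_refl]
    · congr 1
      · ext m
        simp [refl, Fin.rev_succ]
      · ext m
        simp [refl, Fin.rev_castSucc]
      · ext z
        congr 1
        · rw [← Equiv.prod_comp Fin.revPerm]
          refine Finset.prod_congr rfl fun m _ => ?_
          congr 1
          simp [refl, revTuple, Fin.rev_succ]
          ring
        · congr 1
          have e : Fin.init y = refl (Fin.tail (refl y)) := by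
            ext j
            simp [Fin.init, refl, Fin.tail, Fin.rev_succ]
          rw [refl_extend (revTuple_injective hi), revTuple_revTuple, e]
    · refine Continuous.mul (by fun_prop) (hf.comp ?_)
      exact (continuous_extend _).comp (f := fun z => (z, Fin.init y)) (by fun_prop)

theorem bMinus_eq_bPlus {N : ℕ} (γ : ℝ) (μ : ℂ) {f : (Fin N → ℝ) → ℂ} (hf : Continuous f)
    (y : Fin (N + 1) → ℝ) :
    bMinus γ μ f y = bPlus γ (-μ) (fun z => f (refl z)) (refl y) := by
  refine Finset.sum_congr rfl fun n _ => ?_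
  congr 1
  refine Finset.sum_nbij' revTuple revTuple ?_ ?_ ?_ ?_ ?_
  · intro i hi
    exact Finset.mem_filter.2 ⟨mem_univ _, revTuple_injective (Finset.mem_filter.1 hi).2⟩
  · intro i hi
    exact Finset.mem_filter.2 ⟨mem_univ _, revTuple_injective (Finset.mem_filter.1 hi).2⟩
  · exact fun i _ => revTuple_revTuple i
  · exact fun i _ => revTuple_revTuple i
  · exact fun i hi => elemMinus_eq_elemPlus μ (Finset.mem_filter.1 hi).2 hf y

theorem aMinus_psi {N : ℕ} (γ xm : ℝ) (μ : ℂ) (lam : Fin N → ℂ) (x : Fin N → ℝ) :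
    aMinus γ xm μ (psi γ lam) x = aPlus γ (-xm) (-μ) (psi γ (refl lam)) (refl x) := by
  have hc : Continuous (psi γ lam) :=
    (continuous_psi γ).comp (f := fun x : Fin N → ℝ => (lam, x)) (by fun_prop)
  rw [aMinus, aPlus, bMinus_eq_bPlus γ μ hc, refl_snoc]
  congr 1
  ext z
  rw [← psi_refl γ lam, refl_refl]

/-- Negating the parameters flips the sign of each denominator, which accounts for the opposite sign
of $i\gamma$ in the two recursions; reversal matches the last label with the first. -/
theorem coeffMinusSet_eq (γ xm : ℝ) : ∀ {N : ℕ} (lam : Fin N → ℂ) (μ : ℂ) {S S' : Finset (Fin N)},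
    (∀ j, j ∈ S' ↔ j.rev ∈ S) →
      coeffMinusSet γ xm N lam μ S = coeffPlusSet γ (-xm) N (refl lam) (-μ) S'
  | 0, _, μ, _, _, _ => by simp [coeffMinusSet, coeffPlusSet]
  | N + 1, lam, μ, S, S', h => by
    have h0 : 0 ∈ S' ↔ Fin.last N ∈ S := by rw [h, Fin.rev_zero]
    have ht : Fin.tail (refl lam) = refl (Fin.init lam) := by
      ext j
      simp [Fin.tail, refl, Fin.init, Fin.rev_succ]
    have hz : refl lam 0 = -lam (Fin.last N) := by simp [refl]
    have hS : ∀ j, j ∈ (univ.filter fun j : Fin N => j.succ ∈ S') ↔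
        j.rev ∈ (univ.filter fun j : Fin N => j.castSucc ∈ S) := by
      intro j
      simp [h, Fin.rev_succ]
    rw [coeffMinusSet, coeffPlusSet]
    simp only [h0, ht, hz]
    rw [← coeffMinusSet_eq γ xm _ _ hS, ← coeffMinusSet_eq γ xm _ _ hS]
    have hd : -lam (Fin.last N) - -μ = -(lam (Fin.last N) - μ) := by ring
    rw [hd]
    congr 2
    · rw [div_neg, neg_div]
    · rw [← neg_div_neg_eq]
      congr 1
      ring

theorem coeffMinus_eq {N n : ℕ} (γ xm : ℝ) (lam : Fin N → ℂ) (μ : ℂ) (i : Fin n → Fin N) :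
    coeffMinus γ xm lam μ i = coeffPlus γ (-xm) (refl lam) (-μ) (revTuple i) := by
  refine coeffMinusSet_eq γ xm lam μ fun j => ?_
  simp only [mem_image, mem_univ, true_and, revTuple]
  constructor
  · rintro ⟨m, rfl⟩
    exact ⟨m.rev, by simp⟩
  · rintro ⟨m, hm⟩
    exact ⟨m.rev, by simp [hm]⟩

theorem refl_shiftMinus {N n : ℕ} (lam : Fin N → ℂ) (μ : ℂ) {i : Fin n → Fin N}
    (hi : Function.Injective i) :
    refl (shiftMinus lam μ i) = shiftPlus (refl lam) (-μ) (revTuple i) := by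
  rw [shiftMinus, refl_extend hi, shiftPlus]
  congr 1
  have e : (fun k => refl lam (revTuple i k)) = refl fun k => lam (i k) := by
    ext k
    simp [refl, revTuple]
  rw [e, ← refl_snoc]
  ext m
  simp [refl, Fin.rev_castSucc]

theorem betheSumMinus_eq {N : ℕ} (γ xm : ℝ) (lam : Fin N → ℂ) (μ : ℂ) (x : Fin N → ℝ) :
    betheSumMinus γ xm lam μ x = betheSumPlus γ (-xm) (refl lam) (-μ) (refl x) := by
  refine Finset.sum_congr rfl fun n _ => ?_
  refine Finset.sum_nbij' revTuple revTuple ?_ ?_ ?_ ?_ ?_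
  · intro i hi
    exact Finset.mem_filter.2 ⟨mem_univ _, revTuple_strictMono (Finset.mem_filter.1 hi).2⟩
  · intro i hi
    exact Finset.mem_filter.2 ⟨mem_univ _, revTuple_strictMono (Finset.mem_filter.1 hi).2⟩
  · exact fun i _ => revTuple_revTuple i
  · exact fun i _ => revTuple_revTuple i
  · intro i hi
    rw [coeffMinus_eq, ← refl_shiftMinus lam μ (Finset.mem_filter.1 hi).2.injective, psi_refl]

theorem Generic.refl {N : ℕ} {lam : Fin N → ℂ} {μ : ℂ} (h : Generic lam μ) :
    Generic (QNLS.refl lam) (-μ) :=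
  ⟨fun _ _ hjk => Fin.rev_injective (h.1 (neg_injective hjk)),
    fun j hj => h.2 j.rev (neg_injective hj)⟩

theorem tendsto_betheSumMinus {N : ℕ} (γ xm : ℝ) (lam : Fin N → ℂ) (μ : ℂ) {x : Fin N → ℝ}
    (hx : ∀ j, x j ≤ xm) :
    Filter.Tendsto (fun p : (Fin N → ℂ) × ℂ => betheSumMinus γ xm p.1 p.2 x)
      (nhdsWithin (lam, μ) {p | Generic p.1 p.2}) (nhds (aMinus γ xm μ (psi γ lam) x)) := by
  simp only [betheSumMinus_eq, aMinus_psi]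
  refine (tendsto_betheSumPlus γ (-xm) (refl lam) (-μ) (x := refl x)
    fun j => neg_le_neg (hx j.rev)).comp (g := fun p => betheSumPlus γ (-xm) p.1 p.2 (refl x))
    (f := fun p : (Fin N → ℂ) × ℂ => (refl p.1, -p.2)) ?_
  have hc : Continuous fun p : (Fin N → ℂ) × ℂ => (refl p.1, -p.2) := by
    unfold refl
    fun_prop
  exact tendsto_nhdsWithin_of_tendsto_nhds_of_eventually_within _
    ((hc.tendsto (lam, μ)).mono_left nhdsWithin_le_nhds)
    (by filter_upwards [self_mem_nhdsWithin] with p hp using Generic.refl hp)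

end QNLS

theorem mainTheorem5 (γ xp xm : ℝ) (hJ : xp < xm) (N : ℕ) (lam : Fin N → ℂ) (μ : ℂ)
    (x : Fin N → ℝ) (hx : ∀ j, x j ∈ Set.Icc xp xm) :
    ((QNLS.Generic lam μ →
        QNLS.aPlus γ xp μ (QNLS.psi γ lam) x = QNLS.betheSumPlus γ xp lam μ x) ∧
      Filter.Tendsto (fun p : (Fin N → ℂ) × ℂ => QNLS.betheSumPlus γ xp p.1 p.2 x)
        (nhdsWithin (lam, μ) {p | QNLS.Generic p.1 p.2})
        (nhds (QNLS.aPlus γ xp μ (QNLS.psi γ lam) x))) ∧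
    ((QNLS.Generic lam μ →
        QNLS.aMinus γ xm μ (QNLS.psi γ lam) x = QNLS.betheSumMinus γ xm lam μ x) ∧
      Filter.Tendsto (fun p : (Fin N → ℂ) × ℂ => QNLS.betheSumMinus γ xm p.1 p.2 x)
        (nhdsWithin (lam, μ) {p | QNLS.Generic p.1 p.2})
        (nhds (QNLS.aMinus γ xm μ (QNLS.psi γ lam) x))) := by
  refine ⟨⟨QNLS.aPlus_psi_eq_betheSumPlus γ xp fun j => (hx j).1,
    QNLS.tendsto_betheSumPlus γ xp lam μ fun j => (hx j).1⟩, fun hg => ?_,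
    QNLS.tendsto_betheSumMinus γ xm lam μ fun j => (hx j).2⟩
  rw [QNLS.aMinus_psi, QNLS.betheSumMinus_eq]
  exact QNLS.aPlus_psi_eq_betheSumPlus γ (-xm) (fun j => neg_le_neg (hx j.rev).2) hg.refl
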